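/- Let $\Gamma_1$ be the graph obtained from an equilateral triangle by joining the midpoints of its sides ($6$ vertices, $9$ edges). Its edges are labelled by $a,b,c$ as follows: going around the boundary of the big triangle counterclockwise from the lower left corner, the six boundary edges are labelled $a,b,a,b,a,b$, and the three edges of the central triangle are labelled $c$. For $n\ge 1$, let $\Gamma_{n+1}$ be the labelled graph obtained by partitioning an equilateral triangle into four smaller equilateral triangles and putting a (translated) copy of $\Gamma_n$ in each of the three corner triangles, so that any two copies share exactly one outmost vertex (the Sierpiński graphs with the rotation-invariant labelling). For $n\ge 1$ and $w\in\{a,b,c\}$ let $w_n$ be the number of edges labelled $w$ in a uniformly random spanning tree of $\Gamma_n$, and let $\mu_{n,w}$ and $\sigma^2_{n,w}$ be the mean and the variance of $w_n$. 1. For every $n\ge 1$, $$\mu_{n,a}=\mu_{n,b}=\frac{16\cdot 3^n+7}{30},\qquad \mu_{n,c}=\frac{13\cdot 3^n+1}{30},$$ $$\sigma^2_{n,a}=\sigma^2_{n,b}=\frac{199\cdot 3^n+28}{900},\qquad \sigma^2_{n,c}=\frac{34\cdot 3^n-2}{225}.$$ 2. The random variables $a_n,b_n,c_n$ are asymptotically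 normal as $n\to\infty$: for each $w\in\{a,b,c\}$ the normalized variable $W_n=(w_n-\mu_{n,w})/\sigma_{n,w}$ satisfies $$\lim_{n\to\infty}\mathbb{E}\bigl(e^{tW_n}\bigr)=e^{t^2/2}\ \text{ for every } t\in\mathbb{R},\qquad \lim_{n\to\infty}\mathbb{P}(W_n\le x)=\frac1{\sqrt{2\pi}}\int_{-\infty}^x e^{-u^2/2}\,du\ \text{ for every } x\in\mathbb{R}.$$ -/

import Mathlib

open MeasureTheory ProbabilityTheory Filter Topology

/-- The three edge labels. -/
inductive EdgeLabel
  | a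
  | b
  | c
  deriving DecidableEq

namespace Sierpinski

/-- Points of the triangular lattice: `(x, y)` is the point `x • (1, 0) + y • (1/2, √3/2)`. -/
abbrev Pt : Type := ℕ × ℕ

/-- Translation of an edge by a lattice vector. -/
def shiftEdge (v : Pt) (e : Sym2 Pt) : Sym2 Pt := e.map (fun p => p + v)

/-- The vertices of `Γ_n`, `n ≥ 1`. The outmost vertices of `Γ_n` are `(0, 0)` (left),
`(2 ^ n, 0)` (right), `(0, 2 ^ n)` (top); the three corner copies of `Γ_n` in `Γ_{n+1}` are its
translates by `(0, 0)`, `(2 ^ n, 0)`, `(0, 2 ^ n)`. The value at `n = 0` is a placeholder. -/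
def verts : ℕ → Finset Pt
  | 0 => ∅
  | 1 => {(0, 0), (1, 0), (2, 0), (0, 1), (1, 1), (0, 2)}
  | n + 2 => verts (n + 1)
      ∪ (verts (n + 1)).image (fun p => p + (2 ^ (n + 1), 0))
      ∪ (verts (n + 1)).image (fun p => p + (0, 2 ^ (n + 1)))

/-- The edges of `Γ_1` with a given label: on each side of the big triangle one half is labelled
`a` and the other half `b`, in a way invariant under the rotation by `2π/3`; the edges of the
central triangle are labelled `c`. -/
def baseEdges : EdgeLabel → Finset (Sym2 Pt)
  | .a => {s((0, 0), (1, 0)), s((2, 0), (1, 1)), s((0, 2), (0, 1))}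
  | .b => {s((1, 0), (2, 0)), s((1, 1), (0, 2)), s((0, 1), (0, 0))}
  | .c => {s((1, 0), (1, 1)), s((1, 1), (0, 1)), s((0, 1), (1, 0))}

/-- The edges of `Γ_n` with a given label, `n ≥ 1` (the value at `n = 0` is a placeholder). -/
def labelledEdges (w : EdgeLabel) : ℕ → Finset (Sym2 Pt)
  | 0 => ∅
  | 1 => baseEdges w
  | n + 2 => labelledEdges w (n + 1)
      ∪ (labelledEdges w (n + 1)).image (shiftEdge (2 ^ (n + 1), 0))
      ∪ (labelledEdges w (n + 1)).image (shiftEdge (0, 2 ^ (n + 1)))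

/-- All edges of `Γ_n`. -/
def edges (n : ℕ) : Finset (Sym2 Pt) :=
  labelledEdges .a n ∪ labelledEdges .b n ∪ labelledEdges .c n

/-- The graph with vertex set that of `Γ_n` and with edge set `t`. -/
def spanningSubgraph (n : ℕ) (t : Finset (Sym2 Pt)) : SimpleGraph (verts n) :=
  (SimpleGraph.fromEdgeSet (t : Set (Sym2 Pt))).induce (verts n : Set Pt)

/-- The spanning trees of `Γ_n`, each given by its set of edges. -/
def spanningTrees (n : ℕ) : Set (Finset (Sym2 Pt)) :=
  {t | t ⊆ edges n ∧ (spanningSubgraph n t).IsTree}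

/-- The law of a uniformly random spanning tree of `Γ_n`. -/
noncomputable def ust (n : ℕ) : Measure (Finset (Sym2 Pt)) := uniformOn (spanningTrees n)

/-- The number of edges of `Γ_n` labelled `w` in the tree `t`, as a real random variable. -/
def labelCount (n : ℕ) (w : EdgeLabel) (t : Finset (Sym2 Pt)) : ℝ :=
  ((t ∩ labelledEdges w n).card : ℝ)

/-- The mean of the number of `w`-edges. -/
noncomputable def meanCount (n : ℕ) (w : EdgeLabel) : ℝ := ∫ t, labelCount n w t ∂(ust n)

/-- The variance of the number of `w`-edges. -/
noncomputable def varCount (n : ℕ) (w : EdgeLabel) : ℝ := Var[labelCount n w; ust n]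

/-- The number of `w`-edges, centred by its mean and divided by its standard deviation. -/
noncomputable def normalizedCount (n : ℕ) (w : EdgeLabel) (t : Finset (Sym2 Pt)) : ℝ :=
  (labelCount n w t - meanCount n w) / √(varCount n w)

end Sierpinski

/-!
Cut a Sierpiński graph at its three corners. The spanning forests that split the corners in a given
way, with their edges weighted by labels, have generating functions `u` (all corners in one tree),
`v` (one corner separated from the other two) and `w` (all corners separated), and these satisfy a
polynomial recursion under gluing. The relation `u * w = 3 * v ^ 2` holds for `Γ_1` and is
preserved by the recursion, which thereby becomes monomial, so `u` is an explicit product of powers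
of `a + b`, `a * b + b * c + c * a` and `a + b + 3 * c`. When a single label is counted, these
factors are linear, so the number of its edges has the moment generating function of a sum of
independent Bernoulli variables with three parameters. The first two cumulants give the mean and
the variance; as the variance tends to infinity, the second order expansion of the cumulant
generating functions and Lévy's continuity theorem give the asymptotic normality.
-/

namespace Sierpinski

section Colourings

variable {α : Type*}

/-- A two-colouring of the vertices that is constant along the edges in `t`, i.e. a union of
connected components of the graph `t`. Colourings are used to express connectivity, because they
restrict to subgraphs and can be pasted along common vertices. -/
def EdgeConst (t : Finset (Sym2 α)) (f : α → Bool) : Prop := ∀ u v, s(u, v) ∈ t → f u = f v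

/-- `u` and `v` lie in the same connected component of the graph with edge set `t`. -/
def Linked (t : Finset (Sym2 α)) : α → α → Prop :=
  (SimpleGraph.fromEdgeSet (t : Set (Sym2 α))).Reachable

theorem EdgeConst.const (t : Finset (Sym2 α)) (b : Bool) : EdgeConst t fun _ => b :=
  fun _ _ _ => rfl

theorem EdgeConst.mono {t t' : Finset (Sym2 α)} {f : α → Bool} (hf : EdgeConst t' f)
    (h : t ⊆ t') : EdgeConst t f := fun u v huv => hf u v (h huv)

theorem EdgeConst.eq_of_linked {t : Finset (Sym2 α)} {f : α → Bool} (hf : EdgeConst t f)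
    {u v : α} (h : Linked t u v) : f u = f v := by
  rw [Linked, SimpleGraph.reachable_fromEdgeSet_eq_reflTransGen_toRel] at h
  induction h with
  | refl => rfl
  | tail _ hvw ih => exact ih.trans (hf _ _ hvw)

theorem linked_of_mem {t : Finset (Sym2 α)} {u v : α} (h : s(u, v) ∈ t) : Linked t u v := by
  rw [Linked, SimpleGraph.reachable_fromEdgeSet_eq_reflTransGen_toRel]
  exact .single h

open scoped Classical in
theorem edgeConst_linked (t : Finset (Sym2 α)) (u : α) :
    EdgeConst t fun v => decide (Linked t u v) := fun _ _ h =>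
  decide_eq_decide.2 ⟨fun huv => huv.trans (linked_of_mem h),
    fun huv => huv.trans (linked_of_mem h).symm⟩

theorem linked_iff_forall_edgeConst {t : Finset (Sym2 α)} {u v : α} :
    Linked t u v ↔ ∀ f, EdgeConst t f → f u = f v := by
  classical
  refine ⟨fun h f hf => hf.eq_of_linked h, fun h => ?_⟩
  have hu : decide (Linked t u u) = true := by simp [Linked]
  simpa [hu] using h _ (edgeConst_linked t u)

theorem exists_edgeConst_iff {ι : Type*} {t : Finset (Sym2 α)} {τ : ι → α} {x : ι → Bool} :
    (∃ f, EdgeConst t f ∧ ∀ i, f (τ i) = x i) ↔ ∀ i j, Linked t (τ i) (τ j) → x i = x j := by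
  classical
  constructor
  · rintro ⟨f, hf, hx⟩ i j hij
    rw [← hx, ← hx, hf.eq_of_linked hij]
  · refine fun hx => ⟨fun v => decide (∃ i, x i = true ∧ Linked t (τ i) v), fun u v huv => ?_,
      fun i => ?_⟩
    · have huv := linked_of_mem huv
      exact decide_eq_decide.2 <| exists_congr fun i =>
        and_congr_right fun _ => ⟨fun h => h.trans huv, fun h => h.trans huv.symm⟩
    · rw [Bool.eq_iff_iff, decide_eq_true_iff]
      exact ⟨fun ⟨j, hj, hji⟩ => hx j i hji ▸ hj, fun hi => ⟨i, hi, .refl _⟩⟩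

theorem forall_exists_linked_iff {ι : Type*} {t : Finset (Sym2 α)} {V : Finset α} {τ : ι → α} :
    (∀ v ∈ V, ∃ i, Linked t v (τ i)) ↔
      ∀ f, EdgeConst t f → (∀ i, f (τ i) = false) → ∀ v ∈ V, f v = false := by
  classical
  constructor
  · intro h f hf hτ v hv
    obtain ⟨i, hi⟩ := h v hv
    rw [hf.eq_of_linked hi, hτ]
  · intro h v hv
    by_contra! hno
    simpa [Linked] using h _ (edgeConst_linked t v) (by simpa using hno) v hv

/-- The coboundary of a two-colouring: it marks the edges whose endpoints differ. -/
def colourChange (f : α → Bool) : Sym2 α → Bool :=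
  Sym2.lift ⟨fun u v => f u ^^ f v, fun _ _ => Bool.xor_comm _ _⟩

/- If the colourings with zero coboundary that vanish on `S` vanish on `V`, then a colouring of `V`
is determined by its coboundary and its restriction to `S`. -/
theorem card_le_card_edges_add_card {V S : Finset α} {t : Finset (Sym2 α)}
    (hS : ∀ f, EdgeConst t f → (∀ v ∈ S, f v = false) → ∀ v ∈ V, f v = false) :
    V.card ≤ t.card + S.card := by
  classical
  let extend (f : V → Bool) (v : α) : Bool := if h : v ∈ V then f ⟨v, h⟩ else false
  let restrict (f : V → Bool) : t ⊕ S → Bool :=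
    Sum.elim (fun e => colourChange (extend f) e) (fun v => extend f v)
  have hinj : Function.Injective restrict := by
    intro f g hfg
    have hconst : EdgeConst t fun v => extend f v ^^ extend g v := by
      intro u v huv
      have := congrFun hfg (.inl ⟨s(u, v), huv⟩)
      simp only [restrict, Sum.elim_inl, colourChange, Sym2.lift_mk] at this
      have bool_swap : ∀ a b c d : Bool, (a ^^ b) = (c ^^ d) → (a ^^ c) = (b ^^ d) := by decide
      exact bool_swap _ _ _ _ this
    have hzero : ∀ v ∈ S, (extend f v ^^ extend g v) = false := fun v hv => by
      simpa [restrict] using congrFun hfg (.inr ⟨v, hv⟩)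
    ext ⟨v, hv⟩
    simpa [extend, hv] using hS _ hconst hzero v hv
  have hcard := Fintype.card_le_of_injective restrict hinj
  simp only [Fintype.card_pi, Fintype.card_bool, Finset.prod_const, Finset.card_univ,
    Fintype.card_sum, Fintype.card_coe] at hcard
  exact (Nat.pow_le_pow_iff_right one_lt_two).1 hcard

end Colourings

/-- The partitions of a set of three terminals: one block, one isolated terminal and a pair, or
three blocks. -/
inductive TerminalPartition
  | joined
  | isolated (i : Fin 3)
  | separate
  deriving DecidableEq, Fintype

namespace TerminalPartition

/-- The terminals `j` and `k` lie in the same block. -/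
def Rel : TerminalPartition → Fin 3 → Fin 3 → Prop
  | joined, _, _ => True
  | isolated i, j, k => j = k ∨ j ≠ i ∧ k ≠ i
  | separate, j, k => j = k

instance (π : TerminalPartition) (j k : Fin 3) : Decidable (π.Rel j k) := by
  cases π <;> simp only [Rel] <;> infer_instance

/-- The number of blocks. -/
def numBlocks : TerminalPartition → ℕ
  | joined => 1
  | isolated _ => 2
  | separate => 3

/-- The two-colouring `x` of the terminals is constant on the blocks of `π`. -/
def Respects (π : TerminalPartition) (x : Fin 3 → Bool) : Prop := ∀ j k, π.Rel j k → x j = x k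

instance (π : TerminalPartition) (x : Fin 3 → Bool) : Decidable (π.Respects x) := by
  unfold Respects; infer_instance

theorem exists_rel_iff (r : Setoid (Fin 3)) :
    ∃ π : TerminalPartition, ∀ j k, r j k ↔ π.Rel j k := by
  classical
  have of_bool : ∀ r : Fin 3 → Fin 3 → Bool, (∀ i, r i i) → (∀ i j, r i j → r j i) →
      (∀ i j k, r i j → r j k → r i k) →
      ∃ π : TerminalPartition, ∀ j k, r j k ↔ π.Rel j k := by
    decide +kernel
  simpa using of_bool (fun i j => decide (r i j)) (by simp)
    (by simpa using fun _ _ => r.symm) (by simpa using fun _ _ _ => r.trans)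

theorem rel_iff_forall_respects :
    ∀ (π : TerminalPartition) (j k : Fin 3), π.Rel j k ↔ ∀ x, π.Respects x → x j = x k := by
  decide +kernel

theorem eq_of_rel_iff : ∀ π π' : TerminalPartition, (∀ j k, π.Rel j k ↔ π'.Rel j k) → π = π' := by
  decide +kernel

theorem exists_representatives : ∀ π : TerminalPartition, ∃ I : Finset (Fin 3),
    I.card = π.numBlocks ∧
      ∀ x, π.Respects x → (∀ i ∈ I, x i = false) → ∀ i, x i = false := by
  decide +kernel

end TerminalPartition

section Networks

variable {ι α : Type*}

/-- A finite graph without loops, given by its vertices and edges, together with a family of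
distinguished vertices, the terminals, along which networks are glued. -/
structure Network (ι α : Type*) where
  verts : Finset α
  edges : Finset (Sym2 α)
  terminal : ι → α
  mem_verts : ∀ e ∈ edges, ∀ v ∈ e, v ∈ verts
  not_isDiag : ∀ e ∈ edges, ¬ e.IsDiag
  terminal_mem : ∀ i, terminal i ∈ verts

/-- The edge set `t` is a spanning forest of `N` in which every component contains a terminal and
which partitions the terminals according to `π`. Acyclicity is expressed by the number of edges. -/
structure Network.IsForest (N : Network (Fin 3) α) (t : Finset (Sym2 α))
    (π : TerminalPartition) : Prop where
  rooted : ∀ v ∈ N.verts, ∃ i, Linked t v (N.terminal i)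
  linked_iff : ∀ i j, Linked t (N.terminal i) (N.terminal j) ↔ π.Rel i j
  card_add : t.card + π.numBlocks = N.verts.card

namespace Network

variable {N : Network (Fin 3) α} {t : Finset (Sym2 α)} {π : TerminalPartition}

theorem linked_terminal_iff :
    (∀ i j, Linked t (N.terminal i) (N.terminal j) ↔ π.Rel i j) ↔
      ∀ x, π.Respects x ↔ ∃ f, EdgeConst t f ∧ ∀ i, f (N.terminal i) = x i := by
  refine ⟨fun h x => ?_, fun h i j => ?_⟩
  · simp only [exists_edgeConst_iff, h, TerminalPartition.Respects]
  · rw [π.rel_iff_forall_respects, linked_iff_forall_edgeConst]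
    refine ⟨fun hf x hx => ?_, fun hx f hf => hx _ ((h _).2 ⟨f, hf, fun _ => rfl⟩)⟩
    obtain ⟨f, hfc, hfx⟩ := (h x).1 hx
    simpa [hfx] using hf f hfc

theorem isForest_iff_edgeConst : N.IsForest t π ↔
    (∀ f, EdgeConst t f → (∀ i, f (N.terminal i) = false) → ∀ v ∈ N.verts, f v = false) ∧
    (∀ x, π.Respects x ↔ ∃ f, EdgeConst t f ∧ ∀ i, f (N.terminal i) = x i) ∧
    t.card + π.numBlocks = N.verts.card := by
  rw [← forall_exists_linked_iff, ← linked_terminal_iff]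
  exact ⟨fun h => ⟨h.rooted, h.linked_iff, h.card_add⟩, fun ⟨h₁, h₂, h₃⟩ => ⟨h₁, h₂, h₃⟩⟩

theorem exists_linked_terminal_iff (N : Network (Fin 3) α) (t : Finset (Sym2 α)) :
    ∃ π : TerminalPartition, ∀ i j, Linked t (N.terminal i) (N.terminal j) ↔ π.Rel i j :=
  TerminalPartition.exists_rel_iff
    ((SimpleGraph.reachableSetoid (.fromEdgeSet (t : Set (Sym2 α)))).comap N.terminal)

theorem card_verts_le (hroot : ∀ v ∈ N.verts, ∃ i, Linked t v (N.terminal i))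
    (hlink : ∀ i j, Linked t (N.terminal i) (N.terminal j) ↔ π.Rel i j) :
    N.verts.card ≤ t.card + π.numBlocks := by
  classical
  obtain ⟨I, hI, hIx⟩ := π.exists_representatives
  have hzero : ∀ f, EdgeConst t f → (∀ v ∈ I.image N.terminal, f v = false) →
      ∀ v ∈ N.verts, f v = false := fun f hf hfI =>
    forall_exists_linked_iff.1 hroot f hf <| hIx _
      ((linked_terminal_iff.1 hlink _).2 ⟨f, hf, fun _ => rfl⟩)
      fun i hi => hfI _ (Finset.mem_image_of_mem _ hi)
  calc N.verts.card ≤ t.card + (I.image N.terminal).card := card_le_card_edges_add_card hzero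
    _ ≤ t.card + π.numBlocks := by grw [Finset.card_image_le, hI]

theorem IsForest.unique {π' : TerminalPartition} (h : N.IsForest t π) (h' : N.IsForest t π') :
    π = π' :=
  π.eq_of_rel_iff π' fun i j => (h.linked_iff i j).symm.trans (h'.linked_iff i j)

end Network

end Networks

section Gluing

variable {ι α : Type*}

namespace Network

/-- The union of the networks `G i`; its terminal `i` is the terminal `i` of the piece `G i`. -/
def glue [Fintype ι] [DecidableEq α] (G : ι → Network ι α) : Network ι α where
  verts := Finset.univ.biUnion fun i => (G i).verts
  edges := Finset.univ.biUnion fun i => (G i).edges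
  terminal i := (G i).terminal i
  mem_verts e he v hv := by
    simp only [Finset.mem_biUnion, Finset.mem_univ, true_and] at he ⊢
    exact he.imp fun i hi => (G i).mem_verts e hi v hv
  not_isDiag e he := by
    simp only [Finset.mem_biUnion, Finset.mem_univ, true_and] at he
    exact he.elim fun i hi => (G i).not_isDiag e hi
  terminal_mem i := Finset.mem_biUnion.2 ⟨i, Finset.mem_univ i, (G i).terminal_mem i⟩

/-- The pieces `G i` and `G j` share exactly one vertex, which is the terminal `j` of `G i` and the
terminal `i` of `G j`. -/
structure Glueable (G : ι → Network ι α) : Prop where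
  symm : ∀ i j, (G i).terminal j = (G j).terminal i
  inter : ∀ i j, i ≠ j → ∀ v ∈ (G i).verts, v ∈ (G j).verts → v = (G i).terminal j
  injective : ∀ i, Function.Injective (G i).terminal

end Network

open Network

variable {G : ι → Network ι α}

theorem Network.Glueable.disjoint_edges (hG : Glueable G) {i j : ι} (hij : i ≠ j) :
    Disjoint (G i).edges (G j).edges := by
  rw [Finset.disjoint_left]
  intro e hi hj
  induction e using Sym2.ind with | _ u v
  have hu := hG.inter i j hij u ((G i).mem_verts _ hi u (by simp))
    ((G j).mem_verts _ hj u (by simp))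
  have hv := hG.inter i j hij v ((G i).mem_verts _ hi v (by simp))
    ((G j).mem_verts _ hj v (by simp))
  exact (G i).not_isDiag _ hi (Sym2.mk_isDiag_iff.2 (hu.trans hv.symm))

section Pasting

variable [Fintype ι] [DecidableEq α] {t : ι → Finset (Sym2 α)}

theorem Network.Glueable.exists_pasting (hG : Glueable G) (ht : ∀ i, t i ⊆ (G i).edges)
    {f : ι → α → Bool} (hf : ∀ i, EdgeConst (t i) (f i))
    (hterm : ∀ i j, f i ((G i).terminal j) = f j ((G j).terminal i)) :
    ∃ g, EdgeConst (Finset.univ.biUnion t) g ∧ ∀ i, ∀ v ∈ (G i).verts, g v = f i v := by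
  let g (v : α) : Bool := decide (∃ i, v ∈ (G i).verts ∧ f i v = true)
  have agree {i j v} (hi : v ∈ (G i).verts) (hj : v ∈ (G j).verts) : f i v = f j v := by
    rcases eq_or_ne i j with rfl | hij
    · rfl
    · rw [hG.inter i j hij v hi hj, hterm, hG.symm]
  have hg i v (hi : v ∈ (G i).verts) : g v = f i v := by
    rw [Bool.eq_iff_iff, decide_eq_true_iff]
    exact ⟨fun ⟨j, hj, hfj⟩ => agree hi hj ▸ hfj, fun h => ⟨i, hi, h⟩⟩
  refine ⟨g, fun u v huv => ?_, hg⟩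
  obtain ⟨i, -, hi⟩ := Finset.mem_biUnion.1 huv
  rw [hg i u ((G i).mem_verts _ (ht i hi) u (by simp)),
    hg i v ((G i).mem_verts _ (ht i hi) v (by simp)), hf i u v hi]

theorem Network.Glueable.rooted_piece (hG : Glueable G) (ht : ∀ i, t i ⊆ (G i).edges)
    (h : ∀ v ∈ (glue G).verts, ∃ i, Linked (Finset.univ.biUnion t) v ((glue G).terminal i))
    (i : ι) : ∀ v ∈ (G i).verts, ∃ j, Linked (t i) v ((G i).terminal j) := by
  classical
  refine forall_exists_linked_iff.2 fun f hf hf0 v hv => ?_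
  let F : ι → α → Bool := Function.update (fun _ _ => false) i f
  have hFi : F i = f := Function.update_self ..
  have hFj {j} (hj : j ≠ i) : F j = fun _ => false := Function.update_of_ne hj ..
  have hF0 (j k : ι) : F j ((G j).terminal k) = false := by
    rcases eq_or_ne j i with rfl | hj
    · rw [hFi, hf0]
    · rw [hFj hj]
  obtain ⟨g, hg, hgF⟩ := hG.exists_pasting ht (f := F)
    (fun j => by
      rcases eq_or_ne j i with rfl | hj
      · rwa [hFi]
      · rw [hFj hj]
        exact .const _ _)
    fun j k => by rw [hF0, hF0]
  have hg0 (j : ι) : g ((glue G).terminal j) = false :=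
    (hgF j _ ((G j).terminal_mem j)).trans (hF0 j j)
  rw [← hFi, ← hgF i v hv]
  exact forall_exists_linked_iff.1 h g hg hg0 v
    (Finset.mem_biUnion.2 ⟨i, Finset.mem_univ i, hv⟩)

end Pasting

end Gluing

section ThreePieces

/-- The colour of terminal `j` of piece `i` when the outer terminals have colours `x` and the common
vertex of any two pieces has colour `c k`, where `k` is the third piece; the three indices add up
to `0` modulo `3`. -/
def junctionColour (x c : Fin 3 → Bool) (i j : Fin 3) : Bool :=
  if i = j then x i else c (-(i + j))

theorem junctionColour_comm (x c : Fin 3 → Bool) (i j : Fin 3) :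
    junctionColour x c i j = junctionColour x c j i := by
  simp only [junctionColour, eq_comm (a := i), add_comm i]
  grind

theorem eq_junctionColour {y : Fin 3 → Fin 3 → Bool} (hy : ∀ i j, y i j = y j i) (i j : Fin 3) :
    y i j = junctionColour (fun k => y k k) (fun k => y (k + 1) (k + 2)) i j := by
  fin_cases i <;> fin_cases j <;> first | rfl | exact hy _ _

/-- The colours of the terminals of each piece are constant on the blocks of its partition. -/
def Compatible (p : Fin 3 → TerminalPartition) (x c : Fin 3 → Bool) : Prop :=
  ∀ i, (p i).Respects (junctionColour x c i)

instance (p : Fin 3 → TerminalPartition) (x c : Fin 3 → Bool) : Decidable (Compatible p x c) := by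
  unfold Compatible; infer_instance

/-- Gluing three forests that partition the terminals of the pieces according to `p` gives a forest
that partitions the outer terminals according to `π`: every junction is joined to an outer terminal,
the outer terminals are partitioned correctly, and no cycle is closed. -/
structure GluesTo (p : Fin 3 → TerminalPartition) (π : TerminalPartition) : Prop where
  rooted : ∀ c, Compatible p (fun _ => false) c → ∀ i, c i = false
  respects_iff : ∀ x, π.Respects x ↔ ∃ c, Compatible p x c
  sum_numBlocks : ∑ i, (p i).numBlocks = π.numBlocks + 3

instance : DecidableRel GluesTo := fun p π =>
  decidable_of_iff ((∀ c, Compatible p (fun _ => false) c → ∀ i, c i = false) ∧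
      (∀ x, π.Respects x ↔ ∃ c, Compatible p x c) ∧ ∑ i, (p i).numBlocks = π.numBlocks + 3)
    ⟨fun ⟨h₁, h₂, h₃⟩ => ⟨h₁, h₂, h₃⟩, fun h => ⟨h.rooted, h.respects_iff, h.sum_numBlocks⟩⟩

theorem sum_numBlocks_le : ∀ (p : Fin 3 → TerminalPartition) (π : TerminalPartition),
    (∀ c, Compatible p (fun _ => false) c → ∀ i, c i = false) →
    (∀ x, π.Respects x ↔ ∃ c, Compatible p x c) →
    ∑ i, (p i).numBlocks ≤ π.numBlocks + 3 := by
  decide +kernel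

variable {α : Type*} [DecidableEq α] {G : Fin 3 → Network (Fin 3) α}
  {t : Fin 3 → Finset (Sym2 α)} {p : Fin 3 → TerminalPartition} {π : TerminalPartition}

namespace Network

theorem Glueable.card_verts_glue (hG : Glueable G) :
    (glue G).verts.card + 3 = ∑ i, (G i).verts.card := by
  have hinter (i j) (hij : i ≠ j) : (G i).verts ∩ (G j).verts = {(G i).terminal j} := by
    ext v
    simp only [Finset.mem_inter, Finset.mem_singleton]
    refine ⟨fun h => hG.inter i j hij v h.1 h.2, ?_⟩
    rintro rfl
    exact ⟨(G i).terminal_mem j, hG.symm i j ▸ (G j).terminal_mem i⟩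
  have hunion : (glue G).verts = ((G 0).verts ∪ (G 1).verts) ∪ (G 2).verts := by
    ext v
    simp [glue, Fin.exists_fin_succ]
  have htwo : ((G 0).verts ∪ (G 1).verts) ∩ (G 2).verts =
      {(G 2).terminal 0, (G 2).terminal 1} := by
    rw [Finset.union_inter_distrib_right, hinter 0 2 (by decide), hinter 1 2 (by decide),
      hG.symm 0 2, hG.symm 1 2, Finset.singleton_union]
  have h01 := Finset.card_union_add_card_inter (G 0).verts (G 1).verts
  have h012 := Finset.card_union_add_card_inter ((G 0).verts ∪ (G 1).verts) (G 2).verts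
  rw [hinter 0 1 (by decide), Finset.card_singleton] at h01
  rw [htwo, Finset.card_pair ((hG.injective 2).ne (by decide)), ← hunion] at h012
  rw [Fin.sum_univ_three]
  omega

theorem Glueable.card_biUnion (hG : Glueable G) (ht : ∀ i, t i ⊆ (G i).edges) :
    (Finset.univ.biUnion t).card = ∑ i, (t i).card :=
  Finset.card_biUnion fun i _ j _ hij => (hG.disjoint_edges hij).mono (ht i) (ht j)

theorem Glueable.exists_edgeConst_iff_compatible (hG : Glueable G) (ht : ∀ i, t i ⊆ (G i).edges)
    (hp : ∀ i j k, Linked (t i) ((G i).terminal j) ((G i).terminal k) ↔ (p i).Rel j k)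
    {x c : Fin 3 → Bool} :
    (∃ f, EdgeConst (Finset.univ.biUnion t) f ∧
      ∀ i j, f ((G i).terminal j) = junctionColour x c i j) ↔ Compatible p x c := by
  refine ⟨fun ⟨f, hf, hfx⟩ i => ?_, fun h => ?_⟩
  · exact (linked_terminal_iff.1 (hp i) _).2
      ⟨f, hf.mono (Finset.subset_biUnion_of_mem t (Finset.mem_univ i)), hfx i⟩
  · choose f hf hfx using fun i => (linked_terminal_iff.1 (hp i) _).1 (h i)
    obtain ⟨g, hg, hgf⟩ := hG.exists_pasting ht hf fun i j => by
      rw [hfx, hfx, junctionColour_comm]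
    exact ⟨g, hg, fun i j => (hgf i _ ((G i).terminal_mem j)).trans (hfx i j)⟩

theorem Glueable.exists_junctionColour_eq (hG : Glueable G) (f : α → Bool) :
    ∃ c, ∀ i j, f ((G i).terminal j) =
      junctionColour (fun k => f ((glue G).terminal k)) c i j :=
  ⟨_, eq_junctionColour (y := fun i j => f ((G i).terminal j)) fun i j => by rw [hG.symm]⟩

theorem Glueable.exists_edgeConst_glue_iff (hG : Glueable G) (ht : ∀ i, t i ⊆ (G i).edges)
    (hp : ∀ i j k, Linked (t i) ((G i).terminal j) ((G i).terminal k) ↔ (p i).Rel j k)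
    (x : Fin 3 → Bool) :
    (∃ f, EdgeConst (Finset.univ.biUnion t) f ∧ ∀ i, f ((glue G).terminal i) = x i) ↔
      ∃ c, Compatible p x c := by
  simp only [← hG.exists_edgeConst_iff_compatible ht hp]
  constructor
  · rintro ⟨f, hf, hfx⟩
    obtain ⟨c, hc⟩ := hG.exists_junctionColour_eq f
    exact ⟨c, f, hf, by simpa only [hfx] using hc⟩
  · rintro ⟨c, f, hf, hfc⟩
    exact ⟨f, hf, fun i => by simpa [glue, junctionColour] using hfc i i⟩

theorem Glueable.isForest_glue (hG : Glueable G) (ht : ∀ i, t i ⊆ (G i).edges)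
    (hp : GluesTo p π) (h : ∀ i, (G i).IsForest (t i) (p i)) :
    (glue G).IsForest (Finset.univ.biUnion t) π := by
  have hlink := fun i => (h i).linked_iff
  refine isForest_iff_edgeConst.2 ⟨fun f hf hx v hv => ?_, fun x => ?_, ?_⟩
  · obtain ⟨c, hc⟩ := hG.exists_junctionColour_eq f
    simp only [hx] at hc
    have hc0 := hp.rooted c ((hG.exists_edgeConst_iff_compatible ht hlink).1 ⟨f, hf, hc⟩)
    obtain ⟨i, -, hi⟩ := Finset.mem_biUnion.1 hv
    refine forall_exists_linked_iff.1 (h i).rooted f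
      (hf.mono (Finset.subset_biUnion_of_mem t (Finset.mem_univ i))) (fun j => ?_) v hi
    simp [hc, junctionColour, hc0]
  · rw [hG.exists_edgeConst_glue_iff ht hlink, hp.respects_iff]
  · have hcard : ∑ i, ((t i).card + (p i).numBlocks) = ∑ i, (G i).verts.card :=
      Finset.sum_congr rfl fun i _ => (h i).card_add
    rw [Finset.sum_add_distrib, hp.sum_numBlocks, ← hG.card_verts_glue,
      ← hG.card_biUnion ht] at hcard
    omega

theorem Glueable.rooted_gluing (hG : Glueable G) (ht : ∀ i, t i ⊆ (G i).edges)
    (hp : ∀ i j k, Linked (t i) ((G i).terminal j) ((G i).terminal k) ↔ (p i).Rel j k)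
    (h : ∀ v ∈ (glue G).verts, ∃ i, Linked (Finset.univ.biUnion t) v ((glue G).terminal i))
    {c : Fin 3 → Bool} (hc : Compatible p (fun _ => false) c) (k : Fin 3) : c k = false := by
  obtain ⟨f, hf, hfc⟩ := (hG.exists_edgeConst_iff_compatible ht hp).2 hc
  have hf0 := forall_exists_linked_iff.1 h f hf
    (fun i => by simpa [glue, junctionColour] using hfc i i)
  have hk : f ((G (k + 1)).terminal (k + 2)) = c k := by
    rw [hfc]
    fin_cases k <;> rfl
  rw [← hk]
  exact hf0 _ (Finset.mem_biUnion.2 ⟨k + 1, Finset.mem_univ _, (G (k + 1)).terminal_mem _⟩)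

/- Each piece has at least as many edges as a forest with its partition, and the glued graph has
exactly as many as a forest, so equality holds in every piece. -/
theorem Glueable.exists_gluesTo_of_isForest (hG : Glueable G) (ht : ∀ i, t i ⊆ (G i).edges)
    (h : (glue G).IsForest (Finset.univ.biUnion t) π) :
    ∃ p, GluesTo p π ∧ ∀ i, (G i).IsForest (t i) (p i) := by
  choose p hp using fun i => (G i).exists_linked_terminal_iff (t i)
  have hroot := hG.rooted_piece ht h.rooted
  have hglue : ∀ c, Compatible p (fun _ => false) c → ∀ k, c k = false :=
    fun c hc => hG.rooted_gluing ht hp h.rooted hc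
  have hresp : ∀ x, π.Respects x ↔ ∃ c, Compatible p x c := fun x => by
    rw [linked_terminal_iff.1 h.linked_iff, hG.exists_edgeConst_glue_iff ht hp]
  have hblocks := sum_numBlocks_le p π hglue hresp
  have hpiece (i : Fin 3) : (G i).verts.card ≤ (t i).card + (p i).numBlocks :=
    card_verts_le (hroot i) (hp i)
  have htotal := h.card_add
  have hverts := hG.card_verts_glue
  rw [hG.card_biUnion ht] at htotal
  simp only [Fin.sum_univ_three] at hblocks htotal hverts
  have h0 := hpiece 0
  have h1 := hpiece 1
  have h2 := hpiece 2
  refine ⟨p, ⟨hglue, hresp, ?_⟩, fun i => ⟨hroot i, hp i, ?_⟩⟩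
  · rw [Fin.sum_univ_three]
    omega
  · fin_cases i <;> dsimp only [Fin.reduceFinMk, Fin.zero_eta, Fin.mk_one] <;> omega

end Network

end ThreePieces

section ForestSums

open Network

variable {α R : Type*} [CommSemiring R]

open scoped Classical in
/-- The generating function of the spanning forests of `N` that partition the terminals according
to `π`; the edge `e` has weight `ω e`. -/
noncomputable def forestSum (N : Network (Fin 3) α) (ω : Sym2 α → R) (π : TerminalPartition) : R :=
  ∑ t ∈ N.edges.powerset with N.IsForest t π, ∏ e ∈ t, ω e

theorem sum_powerset_biUnion {ι β M : Type*} [Fintype ι] [DecidableEq ι] [DecidableEq β]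
    [AddCommMonoid M] {E : ι → Finset β} (hE : ∀ i j, i ≠ j → Disjoint (E i) (E j))
    (g : Finset β → M) :
    ∑ t ∈ (Finset.univ.biUnion E).powerset, g t =
      ∑ t ∈ Fintype.piFinset fun i => (E i).powerset, g (Finset.univ.biUnion t) := by
  symm
  refine Finset.sum_nbij' (fun t => Finset.univ.biUnion t) (fun t i => t ∩ E i) ?_ ?_ ?_ ?_
    fun _ _ => rfl
  · intro t ht
    simp only [Fintype.mem_piFinset, Finset.mem_powerset] at ht ⊢
    exact Finset.biUnion_mono fun i _ => ht i
  · intro t _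
    simp
  · intro t ht
    simp only [Fintype.mem_piFinset, Finset.mem_powerset] at ht
    ext i e
    simp only [Finset.mem_inter, Finset.mem_biUnion, Finset.mem_univ, true_and]
    refine ⟨fun ⟨⟨j, hj⟩, hi⟩ => ?_, fun h => ⟨⟨i, h⟩, ht i h⟩⟩
    by_contra hti
    have hij : i ≠ j := by
      rintro rfl
      exact hti hj
    exact Finset.disjoint_left.1 (hE i j hij) hi (ht j hj)
  · intro t ht
    rw [← Finset.inter_biUnion, Finset.inter_eq_left.2 (Finset.mem_powerset.1 ht)]

theorem forestSum_glue [DecidableEq α] {G : Fin 3 → Network (Fin 3) α} (hG : Glueable G)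
    (ω : Sym2 α → R) (π : TerminalPartition) :
    forestSum (glue G) ω π =
      ∑ p : Fin 3 → TerminalPartition with GluesTo p π, ∏ i, forestSum (G i) ω (p i) := by
  classical
  have hterm (t) (ht : t ∈ Fintype.piFinset fun i => (G i).edges.powerset) :
      (if (glue G).IsForest (Finset.univ.biUnion t) π then
        ∏ e ∈ Finset.univ.biUnion t, ω e else 0) =
      ∑ p : Fin 3 → TerminalPartition with GluesTo p π,
        ∏ i, if (G i).IsForest (t i) (p i) then ∏ e ∈ t i, ω e else 0 := by
    simp only [Fintype.mem_piFinset, Finset.mem_powerset] at ht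
    rw [Finset.prod_biUnion fun i _ j _ hij => (hG.disjoint_edges hij).mono (ht i) (ht j)]
    split_ifs with h
    · obtain ⟨p, hp, hpt⟩ := hG.exists_gluesTo_of_isForest ht h
      rw [Finset.sum_eq_single_of_mem p (by simpa using hp)]
      · simp only [hpt, if_true]
      · intro q _ hqp
        obtain ⟨i, hi⟩ := Function.ne_iff.1 hqp
        exact Finset.prod_eq_zero (Finset.mem_univ i) (if_neg fun hq => hi (hq.unique (hpt i)))
    · refine (Finset.sum_eq_zero fun p hp => ?_).symm
      obtain ⟨i, hi⟩ : ∃ i, ¬ (G i).IsForest (t i) (p i) := by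
        by_contra! hall
        exact h (hG.isForest_glue ht (by simpa using hp) hall)
      exact Finset.prod_eq_zero (Finset.mem_univ i) (if_neg hi)
  simp only [forestSum, Finset.sum_filter (fun t => IsForest _ t _), Finset.prod_univ_sum]
  rw [show (glue G).edges = Finset.univ.biUnion fun i => (G i).edges from rfl,
    sum_powerset_biUnion fun i j => hG.disjoint_edges, Finset.sum_congr rfl hterm,
    Finset.sum_comm]

/-- The image of a network under an injective relabelling of the vertices. -/
def Network.map {ι α β : Type*} (N : Network ι α) (φ : α ↪ β) : Network ι β where
  verts := N.verts.map φ
  edges := N.edges.map φ.sym2Map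
  terminal i := φ (N.terminal i)
  mem_verts e he v hv := by
    obtain ⟨e', he', rfl⟩ := Finset.mem_map.1 he
    obtain ⟨u, hu, rfl⟩ := Sym2.mem_map.1 hv
    exact Finset.mem_map_of_mem φ (N.mem_verts e' he' u hu)
  not_isDiag e he := by
    obtain ⟨e', he', rfl⟩ := Finset.mem_map.1 he
    exact (Sym2.isDiag_map φ.injective).not.2 (N.not_isDiag e' he')
  terminal_mem i := Finset.mem_map_of_mem φ (N.terminal_mem i)

section Map

variable {β : Type*} (φ : α ↪ β)

theorem edgeConst_map {t : Finset (Sym2 α)} {f : β → Bool} :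
    EdgeConst (t.map φ.sym2Map) f ↔ EdgeConst t (f ∘ φ) := by
  refine ⟨fun h u v huv => h _ _ (Finset.mem_map_of_mem φ.sym2Map huv), fun h u v huv => ?_⟩
  obtain ⟨e, he, heq⟩ := Finset.mem_map.1 huv
  induction e using Sym2.ind with | _ a b
  have hab := h a b he
  rcases Sym2.eq_iff.1 heq with ⟨rfl, rfl⟩ | ⟨rfl, rfl⟩
  exacts [hab, hab.symm]

theorem linked_map {t : Finset (Sym2 α)} {u v : α} :
    Linked (t.map φ.sym2Map) (φ u) (φ v) ↔ Linked t u v := by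
  simp only [linked_iff_forall_edgeConst, edgeConst_map]
  refine ⟨fun h f hf => ?_, fun h f hf => h _ hf⟩
  have hext (w : α) : Function.extend φ f (fun _ => false) (φ w) = f w :=
    φ.injective.extend_apply f _ w
  simpa only [hext] using h (Function.extend φ f fun _ => false)
    (by rwa [Function.extend_comp φ.injective])

theorem isForest_map {N : Network (Fin 3) α} {t : Finset (Sym2 α)} {π : TerminalPartition} :
    (N.map φ).IsForest (t.map φ.sym2Map) π ↔ N.IsForest t π := by
  have rooted_iff :
      (∀ v ∈ (N.map φ).verts, ∃ i, Linked (t.map φ.sym2Map) v ((N.map φ).terminal i)) ↔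
        ∀ v ∈ N.verts, ∃ i, Linked t v (N.terminal i) := by
    simp [Network.map, linked_map]
  have linked_terminal_iff (i j : Fin 3) :
      Linked (t.map φ.sym2Map) ((N.map φ).terminal i) ((N.map φ).terminal j) ↔
        Linked t (N.terminal i) (N.terminal j) := linked_map φ
  have card_verts : (N.map φ).verts.card = N.verts.card := Finset.card_map φ
  have card_edges : (t.map φ.sym2Map).card = t.card := Finset.card_map _
  constructor <;> rintro ⟨hroot, hlink, hcard⟩
  · exact ⟨rooted_iff.1 hroot, fun i j => (linked_terminal_iff i j).symm.trans (hlink i j),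
      by rwa [card_edges, card_verts] at hcard⟩
  · exact ⟨rooted_iff.2 hroot, fun i j => (linked_terminal_iff i j).trans (hlink i j),
      by rwa [card_edges, card_verts]⟩

theorem forestSum_map (N : Network (Fin 3) α) (ω : Sym2 β → R) (π : TerminalPartition) :
    forestSum (N.map φ) ω π = forestSum N (ω ∘ Sym2.map φ) π := by
  classical
  have hpow : (N.map φ).edges.powerset =
      N.edges.powerset.map (Finset.mapEmbedding φ.sym2Map).toEmbedding := by
    ext t
    simp [Network.map, Finset.subset_map_iff, eq_comm]
  rw [forestSum, hpow, Finset.filter_map, Finset.sum_map, forestSum]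
  simp [Function.comp_def, isForest_map]

end Map

end ForestSums

section GluingTable

open TerminalPartition

/-- The triples of partitions which glue to a given partition. By rotation invariance those
gluing to `isolated i` are obtained by rotating the positions of the pieces by `i`. -/
def gluings : TerminalPartition → List (Fin 3 → TerminalPartition)
  | joined => [![joined, joined, isolated 0], ![joined, joined, isolated 1],
      ![joined, isolated 0, joined], ![joined, isolated 2, joined],
      ![isolated 1, joined, joined], ![isolated 2, joined, joined]]
  | isolated i => [![joined, isolated i, isolated i], ![isolated i, joined, isolated i],
      ![isolated i, joined, isolated (i + 1)], ![isolated i, isolated i, joined],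
      ![isolated i, isolated (i + 2), joined], ![isolated (i + 1), joined, isolated i],
      ![isolated (i + 2), isolated i, joined], ![separate, joined, joined]].map
        fun p j => p (j - i)
  | separate => [![joined, isolated 0, separate], ![joined, isolated 1, separate],
      ![joined, separate, isolated 0], ![joined, separate, isolated 2],
      ![isolated 0, joined, separate], ![isolated 0, isolated 0, isolated 1],
      ![isolated 0, isolated 0, isolated 2], ![isolated 0, isolated 1, isolated 0],
      ![isolated 0, isolated 1, isolated 1], ![isolated 0, isolated 2, isolated 0],
      ![isolated 0, isolated 2, isolated 2], ![isolated 0, separate, joined],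
      ![isolated 1, joined, separate], ![isolated 1, isolated 1, isolated 0],
      ![isolated 1, isolated 1, isolated 2], ![isolated 1, isolated 2, isolated 0],
      ![isolated 1, isolated 2, isolated 2], ![isolated 2, isolated 0, isolated 1],
      ![isolated 2, isolated 0, isolated 2], ![isolated 2, isolated 1, isolated 1],
      ![isolated 2, isolated 1, isolated 2], ![isolated 2, separate, joined],
      ![separate, joined, isolated 1], ![separate, joined, isolated 2],
      ![separate, isolated 1, joined], ![separate, isolated 2, joined]]

theorem filter_gluesTo : ∀ π : TerminalPartition,
    Finset.univ.filter (GluesTo · π) = (gluings π).toFinset := by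
  decide +kernel

theorem nodup_gluings : ∀ π : TerminalPartition, (gluings π).Nodup := by
  decide +kernel

theorem forestSum_glue_eq_sum_gluings {α R : Type*} [DecidableEq α] [CommSemiring R]
    {G : Fin 3 → Network (Fin 3) α} (hG : Network.Glueable G) (ω : Sym2 α → R)
    (π : TerminalPartition) :
    forestSum (.glue G) ω π = ((gluings π).map fun p => ∏ i, forestSum (G i) ω (p i)).sum := by
  rw [forestSum_glue hG, filter_gluesTo, List.sum_toFinset _ (nodup_gluings π)]

end GluingTable

section Triangle

/-- The edge of the triangle on the vertices `0, 1, 2` which is opposite to `k`. -/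
def oppositeEdge (k : Fin 3) : Sym2 (Fin 3) := s(k + 1, k + 2)

/-- The triangle, with its three vertices as terminals. -/
def triangle : Network (Fin 3) (Fin 3) where
  verts := Finset.univ
  edges := Finset.univ.image oppositeEdge
  terminal := id
  mem_verts _ _ v _ := Finset.mem_univ v
  not_isDiag := by decide
  terminal_mem _ := Finset.mem_univ _

instance (t : Finset (Sym2 (Fin 3))) (π : TerminalPartition) : Decidable (triangle.IsForest t π) :=
  have (f : Fin 3 → Bool) : Decidable (EdgeConst t f) := by unfold EdgeConst; infer_instance
  decidable_of_iff _ Network.isForest_iff_edgeConst.symm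

theorem filter_isForest_triangle : ∀ π : TerminalPartition,
    triangle.edges.powerset.filter (triangle.IsForest · π) =
      (match π with
        | .joined => {{0, 1}, {1, 2}, {2, 0}}
        | .isolated i => {{i}}
        | .separate => {∅} : Finset (Finset (Fin 3))).image (Finset.image oppositeEdge) := by
  decide +kernel

theorem oppositeEdge_injective : Function.Injective oppositeEdge := by
  decide

theorem forestSum_triangle {R : Type*} [CommSemiring R] (ω : Sym2 (Fin 3) → R)
    (π : TerminalPartition) :
    forestSum triangle ω π =
      match π with
      | .joined => ω (oppositeEdge 0) * ω (oppositeEdge 1) +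
          ω (oppositeEdge 1) * ω (oppositeEdge 2) + ω (oppositeEdge 2) * ω (oppositeEdge 0)
      | .isolated i => ω (oppositeEdge i)
      | .separate => 1 := by
  have hforests := filter_isForest_triangle π
  rw [forestSum, Finset.filter_congr_decidable, hforests,
    Finset.sum_image (Finset.image_injective oppositeEdge_injective).injOn]
  simp only [Finset.prod_image oppositeEdge_injective.injOn]
  cases π with
  | joined =>
    rw [Finset.sum_insert (by decide), Finset.sum_insert (by decide), Finset.sum_singleton,
      Finset.prod_pair (by decide), Finset.prod_pair (by decide), Finset.prod_pair (by decide),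
      add_assoc]
  | isolated i => simp
  | separate => simp

end Triangle

section Geometry

/-- The outmost vertices of `Γ_n`. -/
def corner (n : ℕ) : Fin 3 → Pt := ![(0, 0), (2 ^ n, 0), (0, 2 ^ n)]

theorem corner_injective (n : ℕ) : Function.Injective (corner n) := by
  have : 0 ≠ 2 ^ n := by positivity
  intro i j
  fin_cases i <;> fin_cases j <;> simp [corner, this]

theorem corner_add_self (n : ℕ) (i : Fin 3) : corner n i + corner n i = corner (n + 1) i := by
  fin_cases i <;> simp [corner, pow_succ, mul_two]

/-- The network `Γ_n` with its outmost vertices as terminals. The recursion also makes sense when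
started from a single triangle, which is taken as `Γ_0`. -/
def gasket : ℕ → Network (Fin 3) Pt
  | 0 => triangle.map ⟨corner 0, corner_injective 0⟩
  | n + 1 => .glue fun i => (gasket n).map (addRightEmbedding (corner n i))

theorem terminal_gasket (n : ℕ) : (gasket n).terminal = corner n := by
  induction n with
  | zero => rfl
  | succ n ih =>
    funext i
    change (gasket n).terminal i + corner n i = _
    rw [ih, corner_add_self]

theorem add_le_of_mem_verts_gasket (n : ℕ) : ∀ u ∈ (gasket n).verts, u.1 + u.2 ≤ 2 ^ n := by
  induction n with
  | zero => decide
  | succ n ih =>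
    intro u hu
    obtain ⟨i, -, hu⟩ := Finset.mem_biUnion.1 hu
    obtain ⟨v, hv, rfl⟩ := Finset.mem_map.1 hu
    have hcorner : (corner n i).1 + (corner n i).2 ≤ 2 ^ n := by fin_cases i <;> simp [corner]
    have := ih v hv
    simp only [addRightEmbedding_apply, Prod.fst_add, Prod.snd_add, pow_succ]
    omega

theorem glueable_gasket (n : ℕ) :
    Network.Glueable fun i => (gasket n).map (addRightEmbedding (corner n i)) where
  symm i j := by
    simp only [Network.map, terminal_gasket, addRightEmbedding_apply, add_comm]
  inter i j hij u hi hj := by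
    obtain ⟨p, hp, rfl⟩ := Finset.mem_map.1 hi
    obtain ⟨q, hq, heq⟩ := Finset.mem_map.1 hj
    have hp' := add_le_of_mem_verts_gasket n p hp
    have hq' := add_le_of_mem_verts_gasket n q hq
    have : 0 < 2 ^ n := by positivity
    obtain ⟨p₁, p₂⟩ := p
    obtain ⟨q₁, q₂⟩ := q
    simp only [Network.map, terminal_gasket, addRightEmbedding_apply, Prod.ext_iff, Prod.fst_add,
      Prod.snd_add] at heq hp' hq' ⊢
    fin_cases i <;> fin_cases j <;> simp [corner] at hij heq ⊢ <;> omega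
  injective i := by
    rw [show ((gasket n).map _).terminal = addRightEmbedding (corner n i) ∘ (gasket n).terminal
      from rfl, terminal_gasket]
    exact (addRightEmbedding _).injective.comp (corner_injective n)

theorem verts_succ_eq_gasket (n : ℕ) : verts (n + 1) = (gasket (n + 1)).verts := by
  induction n with
  | zero => decide
  | succ n ih =>
    ext u
    rw [gasket]
    simp [Network.glue, Network.map, verts, ← ih, Fin.exists_fin_succ, corner, -Prod.exists,
      Prod.mk_zero_zero]

theorem mem_labelledEdges_add_two {l : EdgeLabel} {n : ℕ} {e : Sym2 Pt} :
    e ∈ labelledEdges l (n + 2) ↔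
      ∃ i, ∃ e' ∈ labelledEdges l (n + 1), shiftEdge (corner (n + 1) i) e' = e := by
  simp [labelledEdges, Fin.exists_fin_succ, corner, shiftEdge, Prod.mk_zero_zero]

theorem edges_succ_eq_gasket (n : ℕ) : edges (n + 1) = (gasket (n + 1)).edges := by
  induction n with
  | zero => decide
  | succ n ih =>
    have hstep (e : Sym2 Pt) : e ∈ (gasket (n + 2)).edges ↔
        ∃ i, ∃ e' ∈ (gasket (n + 1)).edges, shiftEdge (corner (n + 1) i) e' = e := by
      simp only [gasket, Network.glue, Network.map, Finset.mem_biUnion, Finset.mem_univ, true_and,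
        Finset.mem_map]
      rfl
    ext e
    simp only [hstep, ← ih, edges, Finset.mem_union, mem_labelledEdges_add_two]
    grind

end Geometry

section Labels

/-- The label of an edge, read off its midpoint. The labelling of `Γ_1` is periodic under
translations by even vectors, hence agrees with that of `Γ_n` for all `n ≥ 1`. -/
def edgeLabel (e : Sym2 Pt) : EdgeLabel :=
  match e.add.1 % 4, e.add.2 % 4 with
  | 1, 0 | 3, 1 | 0, 3 => .a
  | 3, 0 | 1, 3 | 0, 1 => .b
  | _, _ => .c

theorem edgeLabel_shiftEdge_two_nsmul (v : Pt) (e : Sym2 Pt) :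
    edgeLabel (shiftEdge (2 • v) e) = edgeLabel e := by
  induction e using Sym2.ind with | _ p q
  have h₁ : (p.1 + 2 * v.1 + (q.1 + 2 * v.1)) % 4 = (p.1 + q.1) % 4 := by omega
  have h₂ : (p.2 + 2 * v.2 + (q.2 + 2 * v.2)) % 4 = (p.2 + q.2) % 4 := by omega
  simp [edgeLabel, shiftEdge, h₁, h₂]

theorem edgeLabel_shiftEdge_corner (n : ℕ) (i : Fin 3) (e : Sym2 Pt) :
    edgeLabel (shiftEdge (corner (n + 1) i) e) = edgeLabel e := by
  rw [← corner_add_self, ← two_nsmul, edgeLabel_shiftEdge_two_nsmul]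

theorem edgeLabel_eq_of_mem (n : ℕ) {l : EdgeLabel} {e : Sym2 Pt}
    (he : e ∈ labelledEdges l (n + 1)) : edgeLabel e = l := by
  induction n generalizing e with
  | zero => revert e; cases l <;> decide
  | succ n ih =>
    obtain ⟨i, e', he', rfl⟩ := mem_labelledEdges_add_two.1 he
    rw [edgeLabel_shiftEdge_corner, ih he']

theorem labelledEdges_eq_filter (l : EdgeLabel) (n : ℕ) :
    labelledEdges l (n + 1) = (edges (n + 1)).filter (edgeLabel · = l) := by
  ext e
  have := @edgeLabel_eq_of_mem n
  simp only [edges, Finset.mem_filter, Finset.mem_union]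
  cases l <;> grind

end Labels

section SpanningTrees

namespace Network

variable {ι α : Type*} {N : Network ι α} {t : Finset (Sym2 α)}

theorem map_subtype_induce (ht : t ⊆ N.edges) :
    ((SimpleGraph.fromEdgeSet (t : Set (Sym2 α))).induce (N.verts : Set α)).map
      (Function.Embedding.subtype _) = .fromEdgeSet (t : Set (Sym2 α)) := by
  ext u v
  simp only [SimpleGraph.map_adj, SimpleGraph.comap_adj, SimpleGraph.fromEdgeSet_adj]
  refine ⟨?_, fun h => ?_⟩
  · rintro ⟨u, v, h, rfl, rfl⟩
    exact h
  · have hmem := N.mem_verts _ (ht h.1)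
    exact ⟨⟨u, hmem u (by simp)⟩, ⟨v, hmem v (by simp)⟩, h, rfl, rfl⟩

theorem card_edgeSet_induce (ht : t ⊆ N.edges) :
    Nat.card ((SimpleGraph.fromEdgeSet (t : Set (Sym2 α))).induce (N.verts : Set α)).edgeSet =
      t.card := by
  have hdiag : (t : Set (Sym2 α)) \ Sym2.diagSet = t :=
    sdiff_eq_left.2 <| Set.disjoint_left.2 fun e he => N.not_isDiag e (ht he)
  rw [Nat.card_coe_set_eq, ← Set.ncard_image_of_injective _
    (Function.Embedding.sym2Map (.subtype _)).injective, ← SimpleGraph.edgeSet_map,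
    map_subtype_induce ht, SimpleGraph.edgeSet_fromEdgeSet, hdiag, Set.ncard_coe_finset]

theorem reachable_induce_iff (ht : t ⊆ N.edges) (u v : (N.verts : Set α)) :
    ((SimpleGraph.fromEdgeSet (t : Set (Sym2 α))).induce (N.verts : Set α)).Reachable u v ↔
      Linked t (u : α) v := by
  refine ⟨fun h => h.map (SimpleGraph.Embedding.induce _).toHom, fun ⟨p⟩ => ?_⟩
  refine ⟨p.induce _ fun w hw => ?_⟩
  rcases p.mem_support_iff_exists_mem_edges.1 hw with rfl | ⟨e, he, hwe⟩
  · exact v.2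
  · have := p.edges_subset_edgeSet he
    rw [SimpleGraph.edgeSet_fromEdgeSet] at this
    exact N.mem_verts e (ht this.1) w hwe

theorem isTree_induce_iff {N : Network (Fin 3) α} (ht : t ⊆ N.edges) :
    ((SimpleGraph.fromEdgeSet (t : Set (Sym2 α))).induce (N.verts : Set α)).IsTree ↔
      N.IsForest t .joined := by
  have : Nonempty (N.verts : Set α) := ⟨⟨_, N.terminal_mem 0⟩⟩
  rw [SimpleGraph.isTree_iff_connected_and_card, card_edgeSet_induce ht,
    SimpleGraph.connected_iff_exists_forall_reachable]
  simp only [reachable_induce_iff ht, Finset.coe_sort_coe, Nat.card_eq_fintype_card,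
    Fintype.card_coe]
  refine ⟨fun ⟨⟨r, hr⟩, hcard⟩ => ⟨fun v hv => ⟨0, ?_⟩, fun i j => ?_, hcard⟩, fun h => ?_⟩
  · exact (hr ⟨v, hv⟩).symm.trans (hr ⟨_, N.terminal_mem 0⟩)
  · exact iff_of_true ((hr ⟨_, N.terminal_mem i⟩).symm.trans (hr ⟨_, N.terminal_mem j⟩)) trivial
  · refine ⟨⟨⟨_, N.terminal_mem 0⟩, fun v => ?_⟩, h.card_add⟩
    obtain ⟨i, hi⟩ := h.rooted v v.2
    exact ((h.linked_iff 0 i).2 trivial).trans hi.symm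

end Network

theorem mem_spanningTrees_succ_iff {n : ℕ} {t : Finset (Sym2 Pt)} :
    t ∈ spanningTrees (n + 1) ↔
      t ⊆ (gasket (n + 1)).edges ∧ (gasket (n + 1)).IsForest t .joined := by
  rw [spanningTrees, Set.mem_ofPred_eq, edges_succ_eq_gasket]
  refine and_congr_right fun ht => ?_
  rw [← Network.isTree_induce_iff ht, ← verts_succ_eq_gasket, spanningSubgraph]

end SpanningTrees

section GeneratingFunctions

open TerminalPartition

variable {R : Type*} [CommSemiring R]

/-- The function on partitions of the terminals with the given values at `joined`, at all
`isolated i`, and at `separate`. -/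
def isotropic (u v w : R) : TerminalPartition → R
  | .joined => u
  | .isolated _ => v
  | .separate => w

theorem forestSum_glue_of_isotropic {α : Type*} [DecidableEq α] {G : Fin 3 → Network (Fin 3) α}
    (hG : Network.Glueable G) {ω : Sym2 α → R} {u v w : R}
    (h : ∀ i, forestSum (G i) ω = isotropic u v w) :
    forestSum (.glue G) ω = isotropic (6 * u ^ 2 * v) (7 * u * v ^ 2 + u ^ 2 * w)
      (14 * v ^ 3 + 12 * u * v * w) := by
  funext π
  simp only [forestSum_glue_eq_sum_gluings hG, h]
  match π with
  | .joined | .isolated 0 | .isolated 1 | .isolated 2 | .separate =>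
    simp only [gluings, isotropic, Fin.prod_univ_three, List.map_cons, List.map_nil, List.sum_cons,
      List.sum_nil, Matrix.cons_val, Fin.isValue, Fin.reduceAdd, Fin.reduceSub, sub_self]
    ring

/-- The factors into which the generating functions of the spanning trees and forests of the
gaskets decompose, as functions of the weights of the three labels. -/
def labelFactor (x : EdgeLabel → R) : Fin 3 → R :=
  ![x .a + x .b, x .a * x .b + x .b * x .c + x .c * x .a, x .a + x .b + 3 * x .c]

theorem forestSum_gasket_one (x : EdgeLabel → R) :
    forestSum (gasket 1) (x ∘ edgeLabel) =
      isotropic (3 * labelFactor x 0 * labelFactor x 1 ^ 2)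
        (labelFactor x 0 * labelFactor x 1 * labelFactor x 2)
        (labelFactor x 0 * labelFactor x 2 ^ 2) := by
  have hlabel : ∀ i k : Fin 3, edgeLabel (Sym2.map (addRightEmbedding (corner 0 i))
      (Sym2.map (corner 0) (oppositeEdge k))) = ![.c, .b, .a] (k - i) := by
    decide
  funext π
  rw [gasket, forestSum_glue_eq_sum_gluings (glueable_gasket 0)]
  simp only [gasket, forestSum_map, forestSum_triangle, Function.comp_apply,
    Function.Embedding.coeFn_mk, hlabel]
  match π with
  | .joined | .isolated 0 | .isolated 1 | .isolated 2 | .separate =>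
    simp only [gluings, isotropic, labelFactor, Fin.prod_univ_three, List.map_cons, List.map_nil,
      List.sum_cons, List.sum_nil, Matrix.cons_val, Fin.isValue, Fin.reduceAdd, Fin.reduceSub,
      sub_self]
    ring

theorem forestSum_gasket_succ {x : EdgeLabel → R} {n : ℕ} {u v w : R}
    (h : forestSum (gasket (n + 1)) (x ∘ edgeLabel) = isotropic u v w) :
    forestSum (gasket (n + 2)) (x ∘ edgeLabel) = isotropic (6 * u ^ 2 * v)
      (7 * u * v ^ 2 + u ^ 2 * w) (14 * v ^ 3 + 12 * u * v * w) := by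
  refine forestSum_glue_of_isotropic (glueable_gasket (n + 1)) fun i => ?_
  have hshift : x ∘ edgeLabel ∘ Sym2.map (addRightEmbedding (corner (n + 1) i)) =
      x ∘ edgeLabel := by
    funext e
    exact congrArg x (edgeLabel_shiftEdge_corner n i e)
  rw [← h]
  funext π
  rw [forestSum_map, Function.comp_assoc, hshift]

/-- The number of times that three copies of a gasket are glued to build `Γ_{n+1}` out of copies
of `Γ_1`. -/
def gluingCount (n : ℕ) : ℕ := ∑ i ∈ Finset.range n, 3 ^ i

theorem gluingCount_succ (n : ℕ) : gluingCount (n + 1) = 3 * gluingCount n + 1 :=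
  geom_sum_succ

theorem two_mul_gluingCount_add_one (n : ℕ) : 2 * gluingCount n + 1 = 3 ^ n := by
  rw [mul_comm]
  exact geom_sum_mul_add 2 n

-- The relation `u * w = 3 * v ^ 2` persists and makes the recursion for `(u, v)` monomial.
theorem exists_forestSum_gasket (n : ℕ) : ∃ a b : ℕ, 0 < a ∧ 0 < b ∧ ∀ x : EdgeLabel → R,
    ∃ u v w : R, forestSum (gasket (n + 1)) (x ∘ edgeLabel) = isotropic u v w ∧
      u * w = 3 * v ^ 2 ∧
      u = a * (labelFactor x 0 ^ (2 * gluingCount n + 1) *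
        labelFactor x 1 ^ (3 * gluingCount n + 2) * labelFactor x 2 ^ gluingCount n) ∧
      v = b * (labelFactor x 0 ^ (2 * gluingCount n + 1) *
        labelFactor x 1 ^ (3 * gluingCount n + 1) * labelFactor x 2 ^ (gluingCount n + 1)) := by
  induction n with
  | zero =>
    refine ⟨3, 1, by norm_num, by norm_num, fun x => ⟨_, _, _, forestSum_gasket_one x, ?_, ?_, ?_⟩⟩
    · ring
    · simp [gluingCount, mul_assoc]
    · simp [gluingCount]
  | succ n ih =>
    obtain ⟨a, b, ha, hb, ih⟩ := ih
    refine ⟨6 * a ^ 2 * b, 10 * a * b ^ 2, by positivity, by positivity, fun x => ?_⟩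
    obtain ⟨u, v, w, hsum, huw, hu, hv⟩ := ih x
    have hv' : 7 * u * v ^ 2 + u ^ 2 * w = 10 * u * v ^ 2 := by
      calc 7 * u * v ^ 2 + u ^ 2 * w = 7 * u * v ^ 2 + u * (u * w) := by ring
        _ = 10 * u * v ^ 2 := by rw [huw]; ring
    have hw' : 14 * v ^ 3 + 12 * u * v * w = 50 * v ^ 3 := by
      calc 14 * v ^ 3 + 12 * u * v * w = 14 * v ^ 3 + 12 * v * (u * w) := by ring
        _ = 50 * v ^ 3 := by rw [huw]; ring
    refine ⟨_, _, _, forestSum_gasket_succ hsum, ?_, ?_, ?_⟩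
    · rw [hv', hw']
      ring
    · rw [hu, hv, gluingCount_succ]
      push_cast
      ring
    · rw [hv', hu, hv, gluingCount_succ]
      push_cast
      ring

end GeneratingFunctions

section Bernoulli

open Asymptotics
open Complex (exp log slitPlane)

theorem isLittleO_sub_taylor_two {𝕜 : Type*} [RCLike 𝕜] {f f' : 𝕜 → 𝕜} {c : 𝕜}
    (hf : ∀ᶠ s in 𝓝 0, HasDerivAt f (f' s) s) (hf' : HasDerivAt f' c 0) :
    (fun s => f s - f 0 - f' 0 * s - c / 2 * s ^ 2) =o[𝓝 0] fun s => s ^ 2 := by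
  have hrem : (fun s => f' s - f' 0 - c * s) =o[𝓝 0] fun s => s := by
    simpa [mul_comm c] using hf'.isLittleO
  have hderiv : ∀ᶠ s in 𝓝 0, HasDerivAt (fun s => f s - f 0 - f' 0 * s - c / 2 * s ^ 2)
      (f' s - f' 0 - c * s) s := by
    filter_upwards [hf] with s hs
    refine (((hs.sub_const (f 0)).sub ((hasDerivAt_id s).const_mul (f' 0))).sub
      ((hasDerivAt_pow 2 s).const_mul (c / 2))).congr_deriv ?_
    push_cast
    ring
  refine isLittleO_iff.2 fun ε hε => ?_
  obtain ⟨δ, hδ, hball⟩ := Metric.eventually_nhds_iff_ball.1 (hderiv.and (isLittleO_iff.1 hrem hε))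
  refine Metric.eventually_nhds_iff_ball.2 ⟨δ, hδ, fun s hs => ?_⟩
  have hsub : Metric.closedBall (0 : 𝕜) ‖s‖ ⊆ Metric.ball 0 δ :=
    Metric.closedBall_subset_ball (by simpa using hs)
  have hmean := (convex_closedBall (0 : 𝕜) ‖s‖).norm_image_sub_le_of_norm_hasDerivWithin_le
    (C := ε * ‖s‖) (x := 0) (y := s) (fun x hx => (hball x (hsub hx)).1.hasDerivWithinAt)
    (fun x hx => (hball x (hsub hx)).2.trans (by gcongr; simpa using hx)) (by simp) (by simp)
  simpa [pow_two, mul_assoc] using hmean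

/-- The cumulant generating function of the Bernoulli law of parameter `p`, near `0`. -/
noncomputable def bernoulliCGF (p : ℝ) (z : ℂ) : ℂ := log (1 - p + p * exp z)

theorem eventually_mem_slitPlane (p : ℝ) :
    ∀ᶠ z : ℂ in 𝓝 0, 1 - (p : ℂ) + p * exp z ∈ slitPlane := by
  have hcont : Continuous fun z : ℂ => 1 - (p : ℂ) + p * exp z := by fun_prop
  exact hcont.continuousAt.eventually (Complex.isOpen_slitPlane.mem_nhds (by simp))

theorem bernoulliCGF_zero (p : ℝ) : bernoulliCGF p 0 = 0 := by
  simp [bernoulliCGF]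

theorem eventually_exp_bernoulliCGF (p : ℝ) :
    ∀ᶠ z in 𝓝 0, exp (bernoulliCGF p z) = 1 - p + p * exp z := by
  filter_upwards [eventually_mem_slitPlane p] with z hz
  exact Complex.exp_log (Complex.slitPlane_ne_zero hz)

theorem hasDerivAt_one_sub_add_mul_exp (p : ℝ) (z : ℂ) :
    HasDerivAt (fun z => 1 - (p : ℂ) + p * exp z) (p * exp z) z :=
  ((Complex.hasDerivAt_exp z).const_mul (p : ℂ)).const_add _

theorem eventually_hasDerivAt_bernoulliCGF (p : ℝ) :
    ∀ᶠ z in 𝓝 0, HasDerivAt (bernoulliCGF p) (p * exp z / (1 - p + p * exp z)) z := by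
  filter_upwards [eventually_mem_slitPlane p] with z hz
  exact (hasDerivAt_one_sub_add_mul_exp p z).clog hz

theorem hasDerivAt_deriv_bernoulliCGF_zero (p : ℝ) :
    HasDerivAt (fun z => p * exp z / (1 - p + p * exp z)) (p * (1 - p)) 0 := by
  refine (((Complex.hasDerivAt_exp 0).const_mul (p : ℂ)).div
    (hasDerivAt_one_sub_add_mul_exp p 0) (by simp)).congr_deriv ?_
  simp only [Complex.exp_zero, mul_one, sub_add_cancel]
  ring

theorem isLittleO_bernoulliCGF (p : ℝ) :
    (fun z => bernoulliCGF p z - p * z - p * (1 - p) / 2 * z ^ 2) =o[𝓝 0] fun z => z ^ 2 := by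
  simpa [bernoulliCGF_zero] using isLittleO_sub_taylor_two (eventually_hasDerivAt_bernoulliCGF p)
    (hasDerivAt_deriv_bernoulliCGF_zero p)

theorem eventually_bernoulliCGF_eq_mul {p : ℝ} (hp : p * (1 - p) = 0) :
    ∀ᶠ z in 𝓝 0, bernoulliCGF p z = p * z := by
  obtain rfl | hp := mul_eq_zero.1 hp
  · simp [bernoulliCGF]
  · obtain rfl : p = 1 := (sub_eq_zero.1 hp).symm
    have him : ∀ᶠ z : ℂ in 𝓝 0, z.im ∈ Set.Ioo (-Real.pi) Real.pi :=
      Complex.continuous_im.continuousAt.eventually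
        (Ioo_mem_nhds (by simp [Real.pi_pos]) (by simp [Real.pi_pos]))
    filter_upwards [him] with z hz
    simp [bernoulliCGF, Complex.log_exp hz.1 hz.2.le]

variable {ι : Type*} [Fintype ι] (p : ι → ℝ)

/-- The complex moment generating function of a sum of independent Bernoulli variables, `m i` of
which have the parameter `p i`. -/
noncomputable def bernoulliMGF (m : ι → ℕ) (z : ℂ) : ℂ := ∏ i, (1 - p i + p i * exp z) ^ m i

/-- The mean of a sum of independent Bernoulli variables, `m i` of which have the parameter
`p i`. -/
def bernoulliMean (m : ι → ℕ) : ℝ := ∑ i, m i * p i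

/-- The variance of a sum of independent Bernoulli variables, `m i` of which have the parameter
`p i`. -/
def bernoulliVar (m : ι → ℕ) : ℝ := ∑ i, m i * (p i * (1 - p i))

theorem eventually_bernoulliMGF_eq_exp :
    ∀ᶠ z in 𝓝 0, ∀ m, bernoulliMGF p m z = exp (∑ i, m i * bernoulliCGF (p i) z) := by
  filter_upwards [eventually_all.2 fun i => eventually_exp_bernoulliCGF (p i)] with z hz m
  simp only [bernoulliMGF, Complex.exp_sum, Complex.exp_nat_mul, hz]

theorem eventually_hasDerivAt_sum_bernoulliCGF (m : ι → ℕ) :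
    ∀ᶠ z in 𝓝 0, HasDerivAt (fun z => ∑ i, m i * bernoulliCGF (p i) z)
      (∑ i, m i * (p i * exp z / (1 - p i + p i * exp z))) z := by
  filter_upwards [eventually_all.2 fun i => eventually_hasDerivAt_bernoulliCGF (p i)] with z hz
  exact HasDerivAt.fun_sum fun i _ => (hz i).const_mul _

section Moments

variable {Ω : Type*} [MeasurableSpace Ω] {μ : Measure Ω} {X : Ω → ℝ} {p} {m : ι → ℕ}

theorem eventually_ofReal {P : ℂ → Prop} (h : ∀ᶠ z in 𝓝 0, P z) : ∀ᶠ t : ℝ in 𝓝 0, P t :=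
  Complex.continuous_ofReal.continuousAt.eventually (by simpa using h)

theorem eventually_mgf_eq_exp_re (h : complexMGF X μ = bernoulliMGF p m) :
    ∀ᶠ t in 𝓝 0, mgf X μ t = Real.exp (∑ i, m i * bernoulliCGF (p i) t).re := by
  filter_upwards [eventually_ofReal (eventually_bernoulliMGF_eq_exp p)] with t ht
  rw [← Complex.norm_exp, ← ht, ← h, complexMGF_ofReal, Complex.norm_of_nonneg mgf_nonneg]

theorem zero_mem_interior_integrableExpSet (h : complexMGF X μ = bernoulliMGF p m) :
    0 ∈ interior (integrableExpSet X μ) := by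
  rw [mem_interior_iff_mem_nhds]
  filter_upwards [eventually_mgf_eq_exp_re h] with t ht
  by_contra hint
  exact (Real.exp_pos _).ne (mgf_undef hint ▸ ht)

theorem eventually_hasDerivAt_cgf (h : complexMGF X μ = bernoulliMGF p m) :
    ∀ᶠ t : ℝ in 𝓝 0, HasDerivAt (cgf X μ)
      (∑ i, m i * (p i * exp t / (1 - p i + p i * exp t))).re t := by
  have hcgf : cgf X μ =ᶠ[𝓝 0] fun t : ℝ => (∑ i, m i * bernoulliCGF (p i) t).re := by
    filter_upwards [eventually_mgf_eq_exp_re h] with t ht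
    rw [cgf, ht, Real.log_exp]
  filter_upwards [hcgf.eventually_nhds,
    eventually_ofReal (eventually_hasDerivAt_sum_bernoulliCGF p m)] with t hcgf_t hderiv
  exact hderiv.real_of_complex.congr_of_eventuallyEq hcgf_t

theorem integral_eq_bernoulliMean [IsProbabilityMeasure μ]
    (h : complexMGF X μ = bernoulliMGF p m) : μ[X] = bernoulliMean p m := by
  have hderiv := (eventually_hasDerivAt_cgf h).self_of_nhds.deriv
  rw [deriv_cgf_zero (zero_mem_interior_integrableExpSet h), probReal_univ, div_one] at hderiv
  simp [hderiv, bernoulliMean]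

theorem variance_eq_bernoulliVar [IsProbabilityMeasure μ]
    (h : complexMGF X μ = bernoulliMGF p m) : Var[X; μ] = bernoulliVar p m := by
  have hderiv : deriv (cgf X μ) =ᶠ[𝓝 0]
      fun t : ℝ => (∑ i, m i * (p i * exp t / (1 - p i + p i * exp t))).re := by
    filter_upwards [eventually_hasDerivAt_cgf h] with t ht using ht.deriv
  have hderiv2 : HasDerivAt (fun z => ∑ i, m i * (p i * exp z / (1 - p i + p i * exp z)))
      (∑ i, m i * (p i * (1 - p i) : ℂ)) ((0 : ℝ) : ℂ) :=
    Complex.ofReal_zero ▸ HasDerivAt.fun_sum fun i _ =>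
      (hasDerivAt_deriv_bernoulliCGF_zero (p i)).const_mul _
  have hvar := variance_tilted_mul (zero_mem_interior_integrableExpSet h)
  simp only [zero_mul, tilted_const] at hvar
  rw [hvar, iteratedDeriv_succ, iteratedDeriv_one, hderiv.deriv_eq,
    hderiv2.real_of_complex.deriv, bernoulliVar]
  norm_cast

end Moments

section Limit

variable {p} {κ : Type*} {l : Filter κ}

theorem tendsto_div_sqrt {v : κ → ℝ} (hv : Tendsto v l atTop) (z : ℂ) :
    Tendsto (fun n => z / (√(v n) : ℝ)) l (𝓝 0) := by
  have hinv : Tendsto (fun n => (√(v n))⁻¹) l (𝓝 0) :=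
    (Real.tendsto_sqrt_atTop.comp hv).inv_tendsto_atTop
  simpa [div_eq_mul_inv] using ((Complex.continuous_ofReal.tendsto 0).comp hinv).const_mul z

theorem mul_div_sqrt_sq {v : ℝ} (hv : 0 < v) (z : ℂ) : v * (z / (√v : ℝ)) ^ 2 = z ^ 2 := by
  have hsq : ((√v : ℝ) : ℂ) ^ 2 = v := by rw [← Complex.ofReal_pow, Real.sq_sqrt hv.le]
  rw [div_pow, hsq, mul_div_cancel₀ _ (by exact_mod_cast hv.ne')]

theorem mul_le_bernoulliVar (hp : ∀ i, p i ∈ Set.Icc 0 1) (m : ι → ℕ) (i : ι) :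
    m i * (p i * (1 - p i)) ≤ bernoulliVar p m :=
  Finset.single_le_sum (f := fun i => (m i : ℝ) * (p i * (1 - p i)))
    (fun j _ => mul_nonneg (by positivity) (mul_nonneg (hp j).1 (sub_nonneg.2 (hp j).2)))
    (Finset.mem_univ i)

theorem isBigO_bernoulliVar (hp : ∀ i, p i ∈ Set.Icc 0 1) {i : ι} (hi : p i * (1 - p i) ≠ 0)
    (m : κ → ι → ℕ) :
    (fun n => (m n i : ℂ)) =O[l] fun n => (bernoulliVar p (m n) : ℂ) := by
  have hpos : 0 < p i * (1 - p i) :=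
    (mul_nonneg (hp i).1 (sub_nonneg.2 (hp i).2)).lt_of_ne' hi
  refine IsBigO.of_bound (p i * (1 - p i))⁻¹ (.of_forall fun n => ?_)
  rw [Complex.norm_natCast, Complex.norm_real, inv_mul_eq_div, le_div_iff₀ hpos]
  exact (mul_le_bernoulliVar hp _ i).trans (le_abs_self _)

theorem tendsto_mul_bernoulliCGF_sub (hp : ∀ i, p i ∈ Set.Icc 0 1) {m : κ → ι → ℕ}
    (hm : Tendsto (fun n => bernoulliVar p (m n)) l atTop) (z : ℂ) (i : ι) :
    Tendsto (fun n => (m n i : ℂ) * (bernoulliCGF (p i) (z / (√(bernoulliVar p (m n)) : ℝ)) -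
      p i * (z / (√(bernoulliVar p (m n)) : ℝ)) -
      p i * (1 - p i) / 2 * (z / (√(bernoulliVar p (m n)) : ℝ)) ^ 2)) l (𝓝 0) := by
  have hs := tendsto_div_sqrt hm z
  by_cases hi : p i * (1 - p i) = 0
  · refine tendsto_const_nhds.congr' ?_
    filter_upwards [hs.eventually (eventually_bernoulliCGF_eq_mul hi)] with n hn
    have hi' : (p i * (1 - p i) : ℂ) = 0 := by exact_mod_cast hi
    rw [hn, hi']
    ring
  · refine (isLittleO_one_iff ℂ).1 (((isBigO_bernoulliVar hp hi m).mul_isLittleO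
      ((isLittleO_bernoulliCGF (p i)).comp_tendsto hs)).trans_isBigO ?_)
    refine (isBigO_const_const (z ^ 2) one_ne_zero l).congr' ?_ .rfl
    filter_upwards [hm.eventually_gt_atTop 0] with n hn using (mul_div_sqrt_sq hn z).symm

theorem tendsto_exp_mul_bernoulliMGF (hp : ∀ i, p i ∈ Set.Icc 0 1) {m : κ → ι → ℕ}
    (hm : Tendsto (fun n => bernoulliVar p (m n)) l atTop) (z : ℂ) :
    Tendsto (fun n => exp (-(bernoulliMean p (m n)) * (z / (√(bernoulliVar p (m n)) : ℝ))) *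
      bernoulliMGF p (m n) (z / (√(bernoulliVar p (m n)) : ℝ))) l (𝓝 (exp (z ^ 2 / 2))) := by
  have hlim := (tendsto_finsetSum Finset.univ fun i _ =>
    tendsto_mul_bernoulliCGF_sub hp hm z i).const_add (z ^ 2 / 2)
  rw [Finset.sum_const_zero, add_zero] at hlim
  refine ((Complex.continuous_exp.tendsto _).comp hlim).congr' ?_
  filter_upwards [hm.eventually_gt_atTop 0,
    (tendsto_div_sqrt hm z).eventually (eventually_bernoulliMGF_eq_exp p)] with n hn hmgf
  rw [hmgf, ← Complex.exp_add, Function.comp_apply, ← mul_div_sqrt_sq hn z]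
  congr 1
  generalize z / (√(bernoulliVar p (m n)) : ℝ) = s
  simp only [bernoulliVar, bernoulliMean, Complex.ofReal_sum, Finset.sum_mul, Finset.sum_div,
    neg_mul, ← Finset.sum_neg_distrib, ← Finset.sum_add_distrib]
  refine Finset.sum_congr rfl fun i _ => ?_
  push_cast
  ring

variable {Ω : κ → Type*} [∀ n, MeasurableSpace (Ω n)] {μ : ∀ n, Measure (Ω n)}
  [∀ n, IsProbabilityMeasure (μ n)] {X : ∀ n, Ω n → ℝ}

theorem complexMGF_sub_div {Ω : Type*} [MeasurableSpace Ω] (μ : Measure Ω) (X : Ω → ℝ)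
    (a b : ℝ) (z : ℂ) :
    complexMGF (fun ω => (X ω - a) / b) μ z = exp (-a * (z / b)) * complexMGF X μ (z / b) := by
  rw [complexMGF, complexMGF, ← integral_const_mul]
  congr 1
  funext ω
  rw [← Complex.exp_add]
  push_cast
  ring_nf

theorem tendsto_complexMGF_standardized (hp : ∀ i, p i ∈ Set.Icc 0 1) {m : κ → ι → ℕ}
    (hm : Tendsto (fun n => bernoulliVar p (m n)) l atTop)
    (h : ∀ n, complexMGF (X n) (μ n) = bernoulliMGF p (m n)) (z : ℂ) :
    Tendsto (fun n => complexMGF (fun ω => (X n ω - (μ n)[X n]) / √Var[X n; μ n]) (μ n) z) l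
      (𝓝 (exp (z ^ 2 / 2))) := by
  simp only [complexMGF_sub_div, h, integral_eq_bernoulliMean (h _), variance_eq_bernoulliVar (h _)]
  exact tendsto_exp_mul_bernoulliMGF hp hm z

end Limit

end Bernoulli

section Continuity

variable {κ : Type*} {l : Filter κ}

section

variable {Ω : κ → Type*} [∀ n, MeasurableSpace (Ω n)] {μ : ∀ n, Measure (Ω n)} {X : ∀ n, Ω n → ℝ}

theorem tendsto_mgf_of_tendsto_complexMGF {t a : ℝ}
    (h : Tendsto (fun n => complexMGF (X n) (μ n) t) l (𝓝 a)) :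
    Tendsto (fun n => mgf (X n) (μ n) t) l (𝓝 a) := by
  simp only [complexMGF_ofReal] at h
  exact tendsto_ofReal_iff.1 h

theorem tendsto_measureReal_le_of_tendstoInDistribution {Ω' : Type*} [MeasurableSpace Ω']
    {ν : Measure Ω'} [IsProbabilityMeasure ν] [∀ n, IsProbabilityMeasure (μ n)] {Z : Ω' → ℝ}
    (h : TendstoInDistribution X l Z μ ν) {x : ℝ} (hx : ν.map Z {x} = 0) :
    Tendsto (fun n => (μ n).real {ω | X n ω ≤ x}) l (𝓝 ((ν.map Z).real (Set.Iic x))) := by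
  have := Measure.isProbabilityMeasure_map h.aemeasurable_limit
  have hlim := ProbabilityMeasure.tendsto_measure_of_null_frontier_of_tendsto' h.tendsto
    (E := Set.Iic x) (by rwa [frontier_Iic])
  refine ((ENNReal.tendsto_toReal (measure_ne_top (ν.map Z) _)).comp hlim).congr fun n => ?_
  exact map_measureReal_apply_of_aemeasurable (h.forall_aemeasurable n) measurableSet_Iic

end

theorem tendstoInDistribution_gaussianReal_of_complexMGF {Ω : ℕ → Type*}
    [∀ n, MeasurableSpace (Ω n)] {μ : ∀ n, Measure (Ω n)} [∀ n, IsProbabilityMeasure (μ n)]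
    {X : ∀ n, Ω n → ℝ} (hX : ∀ n, AEMeasurable (X n) (μ n))
    (h : ∀ z, Tendsto (fun n => complexMGF (X n) (μ n) z) atTop (𝓝 (Complex.exp (z ^ 2 / 2)))) :
    TendstoInDistribution X atTop id μ (gaussianReal 0 1) where
  forall_aemeasurable := hX
  tendsto := by
    refine ProbabilityMeasure.tendsto_iff_tendsto_charFun.2 fun t => ?_
    simp only [ProbabilityMeasure.coe_mk, Measure.map_id, charFun_gaussianReal,
      ← complexMGF_mul_I (hX _)]
    convert h (t * Complex.I) using 3
    simp [mul_pow, neg_div]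

end Continuity

section Uniform

theorem integral_uniformOn_finset {Ω : Type*} [MeasurableSpace Ω] [MeasurableSingletonClass Ω]
    {E : Type*} [NormedAddCommGroup E] [NormedSpace ℝ E] [CompleteSpace E] (s : Finset Ω)
    (f : Ω → E) : ∫ ω, f ω ∂uniformOn (s : Set Ω) = (s.card : ℝ)⁻¹ • ∑ ω ∈ s, f ω := by
  have hint : IntegrableOn f (s : Set Ω) Measure.count := by
    rw [← (s : Set Ω).biUnion_of_singleton]
    simp [integrableOn_finset_iUnion]
  rw [uniformOn, ProbabilityTheory.cond, integral_smul_measure, Measure.count_apply_finset,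
    setIntegral_finset s hint]
  simp [Measure.real]

end Uniform

section LabelCounts

open TerminalPartition

/-- The exponents of the factors `labelFactor` in the generating function of the spanning trees of
`Γ_{n+1}`. -/
def factorExponent (n : ℕ) : Fin 3 → ℕ :=
  ![2 * gluingCount n + 1, 3 * gluingCount n + 2, gluingCount n]

theorem exists_forestSum_gasket_joined {R : Type*} [CommSemiring R] (n : ℕ) :
    ∃ a : ℕ, 0 < a ∧ ∀ x : EdgeLabel → R, forestSum (gasket (n + 1)) (x ∘ edgeLabel) .joined =
      a * ∏ i, labelFactor x i ^ factorExponent n i := by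
  obtain ⟨a, _, ha, _, h⟩ := exists_forestSum_gasket (R := R) n
  refine ⟨a, ha, fun x => ?_⟩
  obtain ⟨u, v, w, hsum, -, hu, -⟩ := h x
  rw [hsum, isotropic, hu, Fin.prod_univ_three]
  rfl

/-- The parameters of the Bernoulli variables obtained by normalising the factors `labelFactor`,
when the label `w` is counted. -/
noncomputable def labelParam : EdgeLabel → Fin 3 → ℝ
  | .a | .b => ![1 / 2, 2 / 3, 1 / 5]
  | .c => ![0, 2 / 3, 3 / 5]

theorem labelParam_mem_Icc (w : EdgeLabel) (i : Fin 3) : labelParam w i ∈ Set.Icc 0 1 := by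
  cases w <;> fin_cases i <;> norm_num [labelParam]

theorem labelFactor_mulSingle (w : EdgeLabel) (z : ℂ) (i : Fin 3) :
    labelFactor (Pi.mulSingle w z) i =
      labelFactor 1 i * (1 - labelParam w i + labelParam w i * z) := by
  cases w <;> fin_cases i <;>
    simp only [labelFactor, labelParam, Pi.mulSingle_apply, Pi.one_apply, reduceCtorEq, if_true,
      if_false, Fin.zero_eta, Fin.mk_one, Fin.reduceFinMk, Matrix.cons_val] <;>
    push_cast <;> ring

theorem labelFactor_one_ne_zero (i : Fin 3) : labelFactor (1 : EdgeLabel → ℂ) i ≠ 0 := by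
  fin_cases i <;> norm_num [labelFactor]

theorem forestSum_one_joined_ne_zero (n : ℕ) :
    forestSum (gasket (n + 1)) (1 : Sym2 Pt → ℂ) .joined ≠ 0 := by
  obtain ⟨a, ha, h⟩ := exists_forestSum_gasket_joined (R := ℂ) n
  change forestSum (gasket (n + 1)) ((1 : EdgeLabel → ℂ) ∘ edgeLabel) .joined ≠ 0
  rw [h]
  exact mul_ne_zero (by exact_mod_cast ha.ne') <|
    Finset.prod_ne_zero_iff.2 fun i _ => pow_ne_zero _ (labelFactor_one_ne_zero i)

theorem forestSum_mulSingle_joined (n : ℕ) (w : EdgeLabel) (z : ℂ) :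
    forestSum (gasket (n + 1)) (Pi.mulSingle w (Complex.exp z) ∘ edgeLabel) .joined =
      forestSum (gasket (n + 1)) 1 .joined * bernoulliMGF (labelParam w) (factorExponent n) z := by
  obtain ⟨a, -, h⟩ := exists_forestSum_gasket_joined (R := ℂ) n
  have hone := h 1
  rw [Pi.one_comp] at hone
  simp only [h, hone, labelFactor_mulSingle, mul_pow, Finset.prod_mul_distrib, bernoulliMGF,
    mul_assoc]

open scoped Classical in
theorem coe_filter_isForest_joined (n : ℕ) :
    (((gasket (n + 1)).edges.powerset.filter ((gasket (n + 1)).IsForest · .joined) :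
      Finset (Finset (Sym2 Pt))) : Set (Finset (Sym2 Pt))) = spanningTrees (n + 1) := by
  ext t
  simp [mem_spanningTrees_succ_iff]

theorem integral_prod_ust (n : ℕ) (ω : Sym2 Pt → ℂ) :
    ∫ t, ∏ e ∈ t, ω e ∂ust (n + 1) =
      forestSum (gasket (n + 1)) ω .joined / forestSum (gasket (n + 1)) 1 .joined := by
  classical
  rw [ust, ← coe_filter_isForest_joined, integral_uniformOn_finset, Complex.real_smul, mul_comm,
    div_eq_mul_inv]
  simp [forestSum]

instance isProbabilityMeasure_ust (n : ℕ) : IsProbabilityMeasure (ust (n + 1)) := by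
  classical
  rw [ust, ← coe_filter_isForest_joined]
  refine isProbabilityMeasure_uniformOn (Finset.finite_toSet _) ?_
  obtain ⟨t, ht, -⟩ := Finset.exists_ne_zero_of_sum_ne_zero (forestSum_one_joined_ne_zero n)
  exact ⟨t, ht⟩

theorem prod_mulSingle_edgeLabel {R : Type*} [CommMonoid R] {n : ℕ} {t : Finset (Sym2 Pt)}
    (ht : t ⊆ edges (n + 1)) (w : EdgeLabel) (z : R) :
    ∏ e ∈ t, Pi.mulSingle (M := fun _ => R) w z (edgeLabel e) =
      z ^ (t ∩ labelledEdges w (n + 1)).card := by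
  rw [labelledEdges_eq_filter, Finset.inter_filter, Finset.inter_eq_left.2 ht]
  simp [Pi.mulSingle_apply, Finset.prod_ite]

theorem ae_ust_mem_spanningTrees (n : ℕ) : ∀ᵐ t ∂ust (n + 1), t ∈ spanningTrees (n + 1) := by
  classical
  rw [ust, ← coe_filter_isForest_joined]
  exact ae_cond_mem (Finset.measurableSet _)

theorem complexMGF_labelCount (n : ℕ) (w : EdgeLabel) :
    complexMGF (labelCount (n + 1) w) (ust (n + 1)) =
      bernoulliMGF (labelParam w) (factorExponent n) := by
  funext z
  have hprod : ∀ᵐ t ∂ust (n + 1), Complex.exp (z * labelCount (n + 1) w t) =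
      ∏ e ∈ t, (Pi.mulSingle w (Complex.exp z) ∘ edgeLabel : Sym2 Pt → ℂ) e := by
    filter_upwards [ae_ust_mem_spanningTrees n] with t ht
    rw [labelCount, Complex.ofReal_natCast, mul_comm, Complex.exp_nat_mul]
    exact (prod_mulSingle_edgeLabel ht.1 w _).symm
  rw [complexMGF, integral_congr_ae hprod, integral_prod_ust, forestSum_mulSingle_joined,
    mul_div_cancel_left₀ _ (forestSum_one_joined_ne_zero n)]

theorem meanCount_varCount_formulas (n : ℕ) :
    (meanCount (n + 1) .a = (16 * 3 ^ (n + 1) + 7) / 30 ∧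
     meanCount (n + 1) .b = (16 * 3 ^ (n + 1) + 7) / 30 ∧
     meanCount (n + 1) .c = (13 * 3 ^ (n + 1) + 1) / 30) ∧
    (varCount (n + 1) .a = (199 * 3 ^ (n + 1) + 28) / 900 ∧
     varCount (n + 1) .b = (199 * 3 ^ (n + 1) + 28) / 900 ∧
     varCount (n + 1) .c = (34 * 3 ^ (n + 1) - 2) / 225) := by
  have hpow : (3 : ℝ) ^ n = 2 * gluingCount n + 1 := by
    exact_mod_cast (two_mul_gluingCount_add_one n).symm
  simp only [meanCount, varCount, integral_eq_bernoulliMean (complexMGF_labelCount n _),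
    variance_eq_bernoulliVar (complexMGF_labelCount n _), bernoulliMean, bernoulliVar,
    Fin.sum_univ_three, labelParam, factorExponent, Matrix.cons_val, pow_succ, hpow]
  push_cast
  refine ⟨⟨?_, ?_, ?_⟩, ?_, ?_, ?_⟩ <;> ring

theorem tendsto_varCount (w : EdgeLabel) :
    Tendsto (fun n => varCount (n + 1) w) atTop atTop := by
  have hpow : Tendsto (fun n : ℕ => (3 : ℝ) ^ (n + 1)) atTop atTop :=
    (tendsto_pow_atTop_atTop_of_one_lt (by norm_num)).comp (tendsto_add_atTop_nat 1)
  refine tendsto_atTop_mono (fun n => ?_) (hpow.const_mul_atTop (r := 1 / 10) (by norm_num))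
  obtain ⟨-, ha, hb, hc⟩ := meanCount_varCount_formulas n
  have hone : (1 : ℝ) ≤ 3 ^ (n + 1) := one_le_pow₀ (by norm_num)
  cases w <;> linarith

theorem tendsto_complexMGF_normalizedCount (w : EdgeLabel) (z : ℂ) :
    Tendsto (fun n => complexMGF (normalizedCount (n + 1) w) (ust (n + 1)) z) atTop
      (𝓝 (Complex.exp (z ^ 2 / 2))) := by
  refine tendsto_complexMGF_standardized (labelParam_mem_Icc w) ?_
    (fun n => complexMGF_labelCount n w) z
  simpa only [varCount, variance_eq_bernoulliVar (complexMGF_labelCount _ w)] using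
    tendsto_varCount w

theorem tendsto_mgf_normalizedCount (w : EdgeLabel) (t : ℝ) :
    Tendsto (fun n => mgf (normalizedCount n w) (ust n) t) atTop (𝓝 (Real.exp (t ^ 2 / 2))) := by
  rw [← tendsto_add_atTop_iff_nat 1]
  refine tendsto_mgf_of_tendsto_complexMGF ?_
  push_cast
  exact tendsto_complexMGF_normalizedCount w t

theorem tendstoInDistribution_normalizedCount (w : EdgeLabel) :
    TendstoInDistribution (fun n => normalizedCount (n + 1) w) atTop id (fun n => ust (n + 1))
      (gaussianReal 0 1) :=
  tendstoInDistribution_gaussianReal_of_complexMGF (fun _ => Measurable.of_discrete.aemeasurable)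
    (tendsto_complexMGF_normalizedCount w)

theorem tendsto_cdf_normalizedCount (w : EdgeLabel) (x : ℝ) :
    Tendsto (fun n => (ust n).real {t | normalizedCount n w t ≤ x}) atTop
      (𝓝 ((gaussianReal 0 1).real (Set.Iic x))) := by
  rw [← tendsto_add_atTop_iff_nat 1]
  have := nullSingletonClass_gaussianReal (μ := 0) (v := 1) one_ne_zero
  simpa using tendsto_measureReal_le_of_tendstoInDistribution
    (tendstoInDistribution_normalizedCount w) (x := x) (by simp)

end LabelCounts

end Sierpinski

theorem mainTheorem7 :
    (∀ n : ℕ, 1 ≤ n →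
      (Sierpinski.meanCount n EdgeLabel.a = (16 * 3 ^ n + 7) / 30 ∧
       Sierpinski.meanCount n EdgeLabel.b = (16 * 3 ^ n + 7) / 30 ∧
       Sierpinski.meanCount n EdgeLabel.c = (13 * 3 ^ n + 1) / 30) ∧
      (Sierpinski.varCount n EdgeLabel.a = (199 * 3 ^ n + 28) / 900 ∧
       Sierpinski.varCount n EdgeLabel.b = (199 * 3 ^ n + 28) / 900 ∧
       Sierpinski.varCount n EdgeLabel.c = (34 * 3 ^ n - 2) / 225)) ∧
    (∀ w : EdgeLabel,
      (∀ t : ℝ, Tendsto (fun n : ℕ => mgf (Sierpinski.normalizedCount n w) (Sierpinski.ust n) t)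
        atTop (𝓝 (Real.exp (t ^ 2 / 2)))) ∧
      (∀ x : ℝ, Tendsto
        (fun n : ℕ => (Sierpinski.ust n).real {T | Sierpinski.normalizedCount n w T ≤ x})
        atTop (𝓝 ((gaussianReal 0 1).real (Set.Iic x))))) := by
  refine ⟨fun n hn => ?_, fun w => ⟨Sierpinski.tendsto_mgf_normalizedCount w,
    Sierpinski.tendsto_cdf_normalizedCount w⟩⟩
  obtain ⟨m, rfl⟩ := Nat.exists_eq_add_of_le' hn
  exact Sierpinski.meanCount_varCount_formulas m
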